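/- **Setting.** Let $d\in\{2,3\}$ and let $\Omega\subset\mathbb{R}^d$ be a bounded open set with Lipschitz boundary, with exterior unit normal $\boldsymbol n$ (defined almost everywhere on $\partial\Omega$). Let $\partial\Omega_D\subset\partial\Omega$ be measurable. Let $\mu>0$ and $\lambda\in\mathbb{R}$ be Lamé parameters with $2\mu+d\lambda>0$ (in particular any $\lambda\ge 0$), let $\gamma_m,\gamma_a>0$, let $p\ge 0$ be an integer, and let $\kappa,h_0>0$. For $h\in(0,h_0]$ let $\mathcal K_{0,h}$ be a finite conforming mesh of closed convex polytopes that do not overlap, any two distinct elements meeting in a (possibly empty) common face, whose union contains $\Omega$. The mesh is quasiuniform and shape regular with constant $\kappa$: every element has diameter at most $\kappa h$ and contains a ball of radius $h/\kappa$, and every $(d-1)$-dimensional face shared by two elements contains a $(d-1)$-dimensional disc of radius $h/\kappa$ (for simplices the last condition is automatic). Let $\mathcal K_h=\{K\in\mathcal K_{0,h}: K\cap\Omega\ne\emptyset\}$ be the active mesh, $N_h(\Omega)=\bigcup_{K\in\mathcal K_h}K$, and let $\mathcal F_h(\partial\Omega)$ be the set of $(d-1)$-dimensional faces shared by two elements of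 $\mathcal K_h$ at least one of which meets $\partial\Omega$. Let $\boldsymbol V_{0,h}$ be the space of continuous $\mathbb{R}^d$-valued functions on $\bigcup_{K\in\mathcal K_{0,h}}K$ whose restriction to each $K\in\mathcal K_{0,h}$ is a polynomial of total degree at most $p$, and $\boldsymbol V_h=\boldsymbol V_{0,h}|_{N_h(\Omega)}$. Let $(\cdot,\cdot)_\omega$ and $\|\cdot\|_\omega$ denote the $L^2(\omega)$ product and norm (with the Frobenius product for matrices), $\boldsymbol\epsilon(\boldsymbol v)=\tfrac12(\nabla\boldsymbol v+(\nabla\boldsymbol v)^T)$ and $\boldsymbol\sigma(\boldsymbol v)=2\mu\,\boldsymbol\epsilon(\boldsymbol v)+\lambda\,\mathrm{tr}(\boldsymbol\epsilon(\boldsymbol v))I$, and set $$j_h(\boldsymbol v,\boldsymbol w)=\sum_{F\in\mathcal F_h(\partial\Omega)}\sum_{l=1}^p h^{2l+1}\big([D^l_{\boldsymbol n_F}\boldsymbol v],[D^l_{\boldsymbol n_F}\boldsymbol w]\big)_F,$$ where $\boldsymbol n_F$ is a unit normal to $F$, $D^l_{\boldsymbol n_F}$ is the $l$-th derivative in the direction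 $\boldsymbol n_F$ and $[\cdot]$ is the jump across $F$. Further set $$a(\boldsymbol v,\boldsymbol w)=2\mu(\boldsymbol\epsilon(\boldsymbol v),\boldsymbol\epsilon(\boldsymbol w))_\Omega+\lambda(\mathrm{tr}\,\boldsymbol\epsilon(\boldsymbol v),\mathrm{tr}\,\boldsymbol\epsilon(\boldsymbol w))_\Omega,\qquad a_h=a+\gamma_a h^{-2}j_h,$$ $$\|\boldsymbol v\|_{m_h}^2=\|\boldsymbol v\|_\Omega^2+\gamma_m j_h(\boldsymbol v,\boldsymbol v),\qquad \|\boldsymbol v\|_{\nabla,h}^2=\|\nabla\boldsymbol v\|_\Omega^2+\gamma_a h^{-2}j_h(\boldsymbol v,\boldsymbol v),$$ $$b_h(\boldsymbol v,\boldsymbol w)=2\mu(\boldsymbol v,\boldsymbol w)_{\partial\Omega_D}+\lambda(\boldsymbol v\cdot\boldsymbol n,\boldsymbol w\cdot\boldsymbol n)_{\partial\Omega_D},$$ $$|||\boldsymbol v|||_h^2=a_h(\boldsymbol v,\boldsymbol v)+h\|\boldsymbol\sigma(\boldsymbol v)\|^2_{\partial\Omega_D}+h^{-1}b_h(\boldsymbol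 v,\boldsymbol v),$$ where $\boldsymbol\sigma(\boldsymbol v)$ on $\partial\Omega_D$ is the trace from inside $\Omega$. **Lemma (inverse estimates).** There is a constant $C>0$, depending only on $d,\Omega,\mu,\lambda,\gamma_m,\gamma_a,p,\kappa,h_0$ (and not on $h$, on the mesh or its position relative to $\Omega$, on $\partial\Omega_D$, or on $\boldsymbol v$), such that for all $h\in(0,h_0]$, all such meshes and all $\boldsymbol v\in\boldsymbol V_h$: 1. $\|\boldsymbol v\|_{N_h(\Omega)}\le C\,\|\boldsymbol v\|_{m_h}$; 2. $\|\nabla\boldsymbol v\|_{N_h(\Omega)}\le C\,\|\boldsymbol v\|_{\nabla,h}$; 3. $2\mu\|\boldsymbol\epsilon(\boldsymbol v)\|^2_{N_h(\Omega)}+\lambda\|\mathrm{tr}\,\boldsymbol\epsilon(\boldsymbol v)\|^2_{N_h(\Omega)}\le C\,|||\boldsymbol v|||_h^2$, and the same bound holds if $a_h(\boldsymbol v,\boldsymbol v)$ is replaced by $\|\boldsymbol v\|_{\nabla,h}^2$ in the definition of $|||\boldsymbol v|||_h^2$. -/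

import Mathlib

open MeasureTheory Topology Filter Set
open scoped NNReal

noncomputable section

namespace CutFEM

/-- Euclidean space `ℝ^d`. -/
abbrev Vec (d : ℕ) := EuclideanSpace ℝ (Fin d)

variable {d : ℕ}

/-! ### The domain -/

/-- A bounded open set with Lipschitz boundary: near each boundary point, and in a suitable
direction `e`, the set lies strictly above the graph of a Lipschitz function of the component
of the point orthogonal to `e`. -/
structure IsLipschitzDomain (Ω : Set (Vec d)) : Prop where
  isOpen : IsOpen Ω
  isBounded : Bornology.IsBounded Ω
  lipschitz_boundary : ∀ x ∈ frontier Ω, ∃ e : Vec d, ‖e‖ = 1 ∧ ∃ r : ℝ, 0 < r ∧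
    ∃ (L : ℝ≥0) (φ : Vec d → ℝ), LipschitzWith L φ ∧
      ∀ y ∈ Metric.ball x r, y ∈ Ω ↔ φ (y - inner ℝ e y • e) < inner ℝ e y

/-- `ν` is the exterior unit normal to `Ω` at the boundary point `x`: up to an error
`o(‖y - x‖)`, near `x` the set `Ω` is the half space `⟪y - x, ν⟫ < 0`. Such a `ν` is unique. -/
def IsOuterNormal (Ω : Set (Vec d)) (x ν : Vec d) : Prop :=
  ‖ν‖ = 1 ∧ ∀ ε : ℝ, 0 < ε → ∀ᶠ y in 𝓝 x,
    (y ∈ Ω → inner ℝ (y - x) ν ≤ ε * ‖y - x‖) ∧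
    (y ∉ Ω → -(ε * ‖y - x‖) ≤ inner ℝ (y - x) ν)

open Classical in
/-- The exterior unit normal `n`. It exists at almost every point of a Lipschitz boundary; where
there is none the value is `0`. -/
def outerNormal (Ω : Set (Vec d)) (x : Vec d) : Vec d :=
  if hν : ∃ ν, IsOuterNormal Ω x ν then hν.choose else 0

/-! ### The mesh -/

/-- The intersection of two elements is a common face of dimension `d - 1`. -/
def ShareFace (K₁ K₂ : Set (Vec d)) : Prop :=
  Module.finrank ℝ (vectorSpan ℝ (K₁ ∩ K₂)) + 1 = d

/-- A finite conforming quasiuniform mesh with mesh parameter `h` and regularity constant `κ`,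
consisting of (closed) shape regular convex polytopes. For simplices, `inner_disc` follows from
`inner_ball`. -/
structure IsMesh (κ h : ℝ) (𝒦 : Finset (Set (Vec d))) : Prop where
  /-- elements are convex polytopes -/
  polytope : ∀ K ∈ 𝒦, ∃ s : Finset (Vec d), K = convexHull ℝ (s : Set (Vec d))
  /-- distinct elements do not overlap -/
  disjoint : ∀ K ∈ 𝒦, ∀ K' ∈ 𝒦, K ≠ K' → Disjoint (interior K) (interior K')
  /-- the intersection of two distinct elements is a (possibly empty) face of both -/
  conforming : ∀ K ∈ 𝒦, ∀ K' ∈ 𝒦, K ≠ K' → IsExposed ℝ K (K ∩ K')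
  /-- elements have diameter at most of order `h` -/
  diam_le : ∀ K ∈ 𝒦, Metric.diam K ≤ κ * h
  /-- elements contain a ball with radius of order `h` -/
  inner_ball : ∀ K ∈ 𝒦, ∃ c, Metric.closedBall c (h / κ) ⊆ K
  /-- interior faces contain a `(d-1)`-dimensional disc with radius of order `h` -/
  inner_disc : ∀ K ∈ 𝒦, ∀ K' ∈ 𝒦, K ≠ K' → ShareFace K K' →
    ∃ c ∈ K ∩ K', Metric.closedBall c (h / κ) ∩ affineSpan ℝ (K ∩ K') ⊆ K ∩ K'

open Classical in
/-- The active mesh `𝒦_h`: the elements that intersect `Ω`. -/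
def activeMesh (Ω : Set (Vec d)) (𝒦 : Finset (Set (Vec d))) : Finset (Set (Vec d)) :=
  𝒦.filter fun K => (K ∩ Ω).Nonempty

/-- The domain `N_h(Ω)` of the active mesh. -/
def activeDomain (Ω : Set (Vec d)) (𝒦 : Finset (Set (Vec d))) : Set (Vec d) :=
  ⋃ K ∈ activeMesh Ω 𝒦, K

open Classical in
/-- The faces `ℱ_h(∂Ω)`, each given as an ordered pair `(K₁, K₂)` of active elements sharing the
face, such that at least one of the two elements meets `∂Ω`. Each face occurs twice,
as `(K₁, K₂)` and as `(K₂, K₁)`. -/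
def stabFaces (Ω : Set (Vec d)) (𝒦 : Finset (Set (Vec d))) : Finset (Set (Vec d) × Set (Vec d)) :=
  (activeMesh Ω 𝒦 ×ˢ activeMesh Ω 𝒦).filter fun P =>
    P.1 ≠ P.2 ∧ ShareFace P.1 P.2 ∧
      ((P.1 ∩ frontier Ω).Nonempty ∨ (P.2 ∩ frontier Ω).Nonempty)

open Classical in
/-- A unit normal `n_F` to a `(d-1)`-dimensional face `F` (unique up to sign). -/
def faceNormal (F : Set (Vec d)) : Vec d :=
  if hn : ∃ n : Vec d, ‖n‖ = 1 ∧ ∀ x ∈ F, ∀ y ∈ F, inner ℝ n (x - y) = 0 then hn.choose else 0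

/-! ### The finite element space -/

/-- On `K`, the components of `v` are polynomials of total degree at most `p`. -/
def IsPolyOn (p : ℕ) (K : Set (Vec d)) (v : Vec d → Vec d) : Prop :=
  ∃ q : Fin d → MvPolynomial (Fin d) ℝ, (∀ i, (q i).totalDegree ≤ p) ∧
    ∀ x ∈ K, ∀ i, v x i = MvPolynomial.eval (fun j => x j) (q i)

/-- The space `V_{0,h}` on the background mesh. -/
def backgroundSpace (p : ℕ) (𝒦 : Finset (Set (Vec d))) : Set (Vec d → Vec d) :=
  {v | ContinuousOn v (⋃ K ∈ 𝒦, K) ∧ ∀ K ∈ 𝒦, IsPolyOn p K v}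

/-- The finite element space `V_h = V_{0,h}|_{N_h(Ω)}`; values outside `N_h(Ω)` play no role. -/
def feSpace (p : ℕ) (Ω : Set (Vec d)) (𝒦 : Finset (Set (Vec d))) : Set (Vec d → Vec d) :=
  {v | ∃ w ∈ backgroundSpace p 𝒦, EqOn v w (activeDomain Ω 𝒦)}

/-! ### Gradient, strain, stress and `L²` products -/

/-- The gradient, as the matrix `∂_j v_i`. (For `v ∈ V_h` it exists in the interior of each active
element, that is almost everywhere on `N_h(Ω)`.) -/
def grad (v : Vec d → Vec d) (x : Vec d) : Matrix (Fin d) (Fin d) ℝ :=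
  Matrix.of fun i j => fderiv ℝ v x (EuclideanSpace.single j 1) i

/-- The strain `ε(v)`. -/
def strain (v : Vec d → Vec d) (x : Vec d) : Matrix (Fin d) (Fin d) ℝ :=
  (1 / 2 : ℝ) • (grad v x + (grad v x).transpose)

/-- The stress `σ(v) = 2 μ ε(v) + λ tr(ε(v)) I`. -/
def stress (μ lam : ℝ) (v : Vec d → Vec d) (x : Vec d) : Matrix (Fin d) (Fin d) ℝ :=
  (2 * μ) • strain v x + (lam * (strain v x).trace) • (1 : Matrix (Fin d) (Fin d) ℝ)

/-- The trace of `σ(v)` on `∂Ω`, from the inside of `Ω`. -/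
def stressTrace (μ lam : ℝ) (Ω : Set (Vec d)) (v : Vec d → Vec d) (x : Vec d) :
    Matrix (Fin d) (Fin d) ℝ :=
  limUnder (𝓝[>] (0 : ℝ)) fun t => stress μ lam v (x - t • outerNormal Ω x)

/-- The Frobenius product `A : B`. -/
def frob (A B : Matrix (Fin d) (Fin d) ℝ) : ℝ := ∑ i, ∑ j, A i j * B i j

/-- `(v, w)_ω` for vector fields. -/
def l2Vec (ω : Set (Vec d)) (v w : Vec d → Vec d) : ℝ := ∫ x in ω, inner ℝ (v x) (w x)

/-- `(∇v, ∇w)_ω`. -/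
def l2Grad (ω : Set (Vec d)) (v w : Vec d → Vec d) : ℝ := ∫ x in ω, frob (grad v x) (grad w x)

/-- `(ε(v), ε(w))_ω`. -/
def l2Strain (ω : Set (Vec d)) (v w : Vec d → Vec d) : ℝ :=
  ∫ x in ω, frob (strain v x) (strain w x)

/-- `(tr ε(v), tr ε(w))_ω`. -/
def l2Trace (ω : Set (Vec d)) (v w : Vec d → Vec d) : ℝ :=
  ∫ x in ω, (strain v x).trace * (strain w x).trace

/-! ### The forms and norms -/

/-- The jump `[D_n^l v]` at a point `x` of the face `K₁ ∩ K₂`: the difference of the `l`-th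
derivatives in direction `n` of `v|_{K₁}` and of `v|_{K₂}`. -/
def jump (l : ℕ) (K₁ K₂ : Set (Vec d)) (v : Vec d → Vec d) (x : Vec d) : Vec d :=
  iteratedFDerivWithin ℝ l v K₁ x (fun _ => faceNormal (K₁ ∩ K₂)) -
    iteratedFDerivWithin ℝ l v K₂ x (fun _ => faceNormal (K₁ ∩ K₂))

/-- The stabilization form `j_h`. The factor `1/2` compensates for the fact that `stabFaces` lists
each face twice; `μHE[d - 1]` is the surface measure. -/
def jForm (p : ℕ) (h : ℝ) (Ω : Set (Vec d)) (𝒦 : Finset (Set (Vec d))) (v w : Vec d → Vec d) : ℝ :=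
  (1 / 2 : ℝ) * ∑ P ∈ stabFaces Ω 𝒦, ∑ l ∈ Finset.Icc 1 p, h ^ (2 * l + 1) *
    ∫ x in P.1 ∩ P.2, inner ℝ (jump l P.1 P.2 v x) (jump l P.1 P.2 w x) ∂μHE[d - 1]

/-- The form `m`. -/
def mForm (Ω : Set (Vec d)) (v w : Vec d → Vec d) : ℝ := l2Vec Ω v w

/-- The form `2 μ (ε(v), ε(w))_ω + λ (tr ε(v), tr ε(w))_ω`; it is `a` for `ω = Ω`. -/
def aForm (μ lam : ℝ) (ω : Set (Vec d)) (v w : Vec d → Vec d) : ℝ :=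
  2 * μ * l2Strain ω v w + lam * l2Trace ω v w

/-- The stabilized form `m_h = m + γ_m j_h`. -/
def mhForm (γm : ℝ) (p : ℕ) (h : ℝ) (Ω : Set (Vec d)) (𝒦 : Finset (Set (Vec d)))
    (v w : Vec d → Vec d) : ℝ :=
  mForm Ω v w + γm * jForm p h Ω 𝒦 v w

/-- The stabilized form `a_h = a + γ_a h⁻² j_h`. -/
def ahForm (μ lam γa : ℝ) (p : ℕ) (h : ℝ) (Ω : Set (Vec d)) (𝒦 : Finset (Set (Vec d)))
    (v w : Vec d → Vec d) : ℝ :=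
  aForm μ lam Ω v w + γa * (h ^ 2)⁻¹ * jForm p h Ω 𝒦 v w

/-- The squared norm `‖∇v‖²_Ω + γ_a h⁻² ‖v‖²_{j_h}`. -/
def ahGradNormSq (γa : ℝ) (p : ℕ) (h : ℝ) (Ω : Set (Vec d)) (𝒦 : Finset (Set (Vec d)))
    (v : Vec d → Vec d) : ℝ :=
  l2Grad Ω v v + γa * (h ^ 2)⁻¹ * jForm p h Ω 𝒦 v v

/-- The form `b_h(v, w) = 2 μ (v, w)_{∂Ω_D} + λ (v·n, w·n)_{∂Ω_D}`. -/
def bhForm (μ lam : ℝ) (Ω ΓD : Set (Vec d)) (v w : Vec d → Vec d) : ℝ :=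
  ∫ x in ΓD, (2 * μ * inner ℝ (v x) (w x) +
    lam * (inner ℝ (v x) (outerNormal Ω x) * inner ℝ (w x) (outerNormal Ω x))) ∂μHE[d - 1]

/-- The boundary part `h ‖σ(v)‖²_{∂Ω_D} + h⁻¹ ‖v‖²_{b_h}` of the discrete norm. -/
def boundaryNormSq (μ lam : ℝ) (h : ℝ) (Ω ΓD : Set (Vec d)) (v : Vec d → Vec d) : ℝ :=
  h * (∫ x in ΓD, frob (stressTrace μ lam Ω v x) (stressTrace μ lam Ω v x) ∂μHE[d - 1]) +
    h⁻¹ * bhForm μ lam Ω ΓD v v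

/-- The squared discrete norm `|||v|||_h²`, with `‖v‖²_{a_h} = a_h(v, v)`. -/
def tripleNormSq (μ lam γa : ℝ) (p : ℕ) (h : ℝ) (Ω ΓD : Set (Vec d)) (𝒦 : Finset (Set (Vec d)))
    (v : Vec d → Vec d) : ℝ :=
  ahForm μ lam γa p h Ω 𝒦 v v + boundaryNormSq μ lam h Ω ΓD v

/-- The squared discrete norm `|||v|||_h²`, with `‖v‖²_{a_h} = ‖∇v‖²_Ω + γ_a h⁻² ‖v‖²_{j_h}`. -/
def tripleGradNormSq (μ lam γa : ℝ) (p : ℕ) (h : ℝ) (Ω ΓD : Set (Vec d))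
    (𝒦 : Finset (Set (Vec d))) (v : Vec d → Vec d) : ℝ :=
  ahGradNormSq γa p h Ω 𝒦 v + boundaryNormSq μ lam h Ω ΓD v

end CutFEM

end

open CutFEM

noncomputable section

namespace CutFEM

/-! ### Polynomial functions on Euclidean space -/

/-! On each active element the components of `v`, of its gradient and of its strain are polynomials
of degree at most `p` depending linearly on `v` (`IsObservable`). All the estimates reduce to one
inequality for such a quantity `f` of differentiation order `s`: the integral of `f²` over the
active domain is at most a constant times its integral over `Ω` plus `h^(-2s)` times the
stabilization form (`IsObservable.exists_bound`). Strain entries are treated directly, so Korn's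
inequality is not needed.

An active element may meet `Ω` in an arbitrarily small set. It is therefore linked to an element
whose intersection with `Ω` contains a ball of radius comparable to `h`. The interior cone condition
provides a segment of length comparable to `h`, inside `Ω`, ending at the centre of such a ball; a
generic choice of the endpoint makes it pass between elements only through `(d-1)`-dimensional
faces. As long as no element reached lies inside `Ω`, where the walk may stop, every element reached
meets the boundary, so every face crossed is stabilized (`IsLipschitzDomain.exists_chain`).

Across a face the two polynomials agree on the face itself, so a Taylor expansion in the normal
direction writes their difference in terms of the jumps of order `1, ..., p` (`exists_face_bound`).
Volume packing bounds the length of the chain (`IsMesh.card_le`), and equivalence of norms on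
polynomials extrapolates from the ball at its end (`exists_pev_sq_le`). Summation over elements uses
packing again, now as bounded overlap.

For elasticity, `2μ + dλ > 0` makes `a` equivalent to the squared norm of the strain (`aForm_le`,
`le_aForm`), and the boundary terms, being nonnegative, are dropped. -/

/-- The polynomial function on `ℝ^n` defined by `q`. -/
def pev {n : ℕ} (q : MvPolynomial (Fin n) ℝ) (x : Vec n) : ℝ :=
  MvPolynomial.eval (fun j => x j) q

section Poly

variable {n : ℕ}

@[simp] lemma pev_add (q r : MvPolynomial (Fin n) ℝ) (x : Vec n) :
    pev (q + r) x = pev q x + pev r x := by simp [pev]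

@[simp] lemma pev_sub (q r : MvPolynomial (Fin n) ℝ) (x : Vec n) :
    pev (q - r) x = pev q x - pev r x := by simp [pev]

@[simp] lemma pev_smul (a : ℝ) (q : MvPolynomial (Fin n) ℝ) (x : Vec n) :
    pev (a • q) x = a * pev q x := by simp [pev, MvPolynomial.smul_eval]

@[simp] lemma pev_mul (q r : MvPolynomial (Fin n) ℝ) (x : Vec n) :
    pev (q * r) x = pev q x * pev r x := by simp [pev]

@[simp] lemma pev_C (a : ℝ) (x : Vec n) : pev (MvPolynomial.C a) x = a := by simp [pev]

@[simp] lemma pev_zero (x : Vec n) : pev 0 x = 0 := by simp [pev]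

@[simp] lemma pev_X (j : Fin n) (x : Vec n) : pev (MvPolynomial.X j) x = x j := by simp [pev]

@[simp] lemma pev_sum {ι : Type*} (s : Finset ι) (q : ι → MvPolynomial (Fin n) ℝ) (x : Vec n) :
    pev (∑ i ∈ s, q i) x = ∑ i ∈ s, pev (q i) x := by simp [pev]

lemma hasFDerivAt_pev (q : MvPolynomial (Fin n) ℝ) (x : Vec n) :
    HasFDerivAt (pev q)
      (∑ j, pev (MvPolynomial.pderiv j q) x • (EuclideanSpace.proj j : Vec n →L[ℝ] ℝ)) x := by
  induction q using MvPolynomial.induction_on with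
  | C a =>
    have : (pev (MvPolynomial.C a) : Vec n → ℝ) = fun _ => a := by ext; simp
    rw [this]
    simpa using hasFDerivAt_const a x
  | add p q hp hq =>
    have : (pev (p + q) : Vec n → ℝ) = fun x => pev p x + pev q x := by ext; simp
    rw [this]
    refine (hp.fun_add hq).congr_fderiv ?_
    simp [add_smul, Finset.sum_add_distrib]
  | mul_X p i hp =>
    have : (pev (p * MvPolynomial.X i) : Vec n → ℝ) = fun x => pev p x * x i := by ext; simp
    rw [this]
    have h2 : HasFDerivAt (fun x : Vec n => x i) (EuclideanSpace.proj i : Vec n →L[ℝ] ℝ) x :=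
      (EuclideanSpace.proj i : Vec n →L[ℝ] ℝ).hasFDerivAt
    refine (hp.mul h2).congr_fderiv ?_
    ext u
    simp [MvPolynomial.pderiv_X, Pi.single_apply, add_mul,
      Finset.sum_add_distrib, Finset.mul_sum, apply_ite (pev · x)]
    exact Finset.sum_congr rfl fun j _ => by ring

lemma fderiv_pev (q : MvPolynomial (Fin n) ℝ) (x u : Vec n) :
    fderiv ℝ (pev q) x u = ∑ j, pev (MvPolynomial.pderiv j q) x * u j := by
  rw [(hasFDerivAt_pev q x).fderiv]; simp

lemma fderiv_pev_single (q : MvPolynomial (Fin n) ℝ) (x : Vec n) (j : Fin n) :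
    fderiv ℝ (pev q) x (EuclideanSpace.single j 1) = pev (MvPolynomial.pderiv j q) x := by
  rw [fderiv_pev]; simp

lemma contDiff_pev (q : MvPolynomial (Fin n) ℝ) {k : WithTop ℕ∞} : ContDiff ℝ k (pev q) := by
  induction q using MvPolynomial.induction_on with
  | C a =>
    have : (pev (MvPolynomial.C a) : Vec n → ℝ) = fun _ => a := by ext; simp
    rw [this]; exact contDiff_const
  | add p q hp hq =>
    have : (pev (p + q) : Vec n → ℝ) = fun x => pev p x + pev q x := by ext; simp
    rw [this]; exact hp.add hq
  | mul_X p i hp =>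
    have : (pev (p * MvPolynomial.X i) : Vec n → ℝ) = fun x => pev p x * x i := by ext; simp
    rw [this]; exact hp.mul (EuclideanSpace.proj i : Vec n →L[ℝ] ℝ).contDiff

lemma continuous_pev (q : MvPolynomial (Fin n) ℝ) : Continuous (pev q) :=
  (contDiff_pev q (k := 0)).continuous

/-- The derivative of a polynomial in the direction `u`. -/
def dirDeriv (u : Vec n) : MvPolynomial (Fin n) ℝ →ₗ[ℝ] MvPolynomial (Fin n) ℝ :=
  ∑ j, u j • (MvPolynomial.pderiv j).toLinearMap

lemma dirDeriv_apply (u : Vec n) (q : MvPolynomial (Fin n) ℝ) :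
    dirDeriv u q = ∑ j, u j • MvPolynomial.pderiv j q := by simp [dirDeriv]

lemma fderiv_pev_eq_dirDeriv (q : MvPolynomial (Fin n) ℝ) (x u : Vec n) :
    fderiv ℝ (pev q) x u = pev (dirDeriv u q) x := by
  simp [fderiv_pev, dirDeriv_apply, mul_comm]

lemma totalDegree_pderiv_le (j : Fin n) (q : MvPolynomial (Fin n) ℝ) :
    (MvPolynomial.pderiv j q).totalDegree ≤ q.totalDegree - 1 := by
  refine Finset.sup_le fun s hs => ?_
  rw [MvPolynomial.mem_support_iff, MvPolynomial.coeff_pderiv] at hs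
  have hs' : s + Finsupp.single j 1 ∈ q.support := by
    rw [MvPolynomial.mem_support_iff]; intro h; simp [h] at hs
  have := MvPolynomial.le_totalDegree hs'
  rw [Finsupp.sum_add_index' (by simp) (by simp)] at this
  simp at this
  omega

lemma totalDegree_dirDeriv_le (u : Vec n) (q : MvPolynomial (Fin n) ℝ) :
    (dirDeriv u q).totalDegree ≤ q.totalDegree - 1 := by
  rw [dirDeriv_apply]
  exact MvPolynomial.totalDegree_finsetSum_le fun j _ =>
    (MvPolynomial.totalDegree_smul_le _ _).trans (totalDegree_pderiv_le j q)

lemma totalDegree_iterate_dirDeriv_le (u : Vec n) (q : MvPolynomial (Fin n) ℝ) (l : ℕ) :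
    ((dirDeriv u)^[l] q).totalDegree ≤ q.totalDegree := by
  induction l with
  | zero => simp
  | succ l ih =>
    rw [Function.iterate_succ_apply']
    exact (totalDegree_dirDeriv_le u _).trans ((Nat.sub_le _ _).trans ih)

lemma hasDerivAt_pev_line (q : MvPolynomial (Fin n) ℝ) (x u : Vec n) (t : ℝ) :
    HasDerivAt (fun t : ℝ => pev q (x + t • u)) (pev (dirDeriv u q) (x + t • u)) t := by
  have h1 : HasDerivAt (fun t : ℝ => x + t • u) u t := by
    simpa using ((hasDerivAt_id t).smul_const u).const_add x
  have h2 := ((contDiff_pev q (k := 1)).differentiable (by simp) (x + t • u)).hasFDerivAt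
  have := h2.comp_hasDerivAt t h1
  rwa [fderiv_pev_eq_dirDeriv] at this

/-- The exact Taylor formula for polynomials. -/
lemma pev_add_smul (p : ℕ) (q : MvPolynomial (Fin n) ℝ) (hq : q.totalDegree ≤ p) (x u : Vec n)
    (t : ℝ) : pev q (x + t • u) =
      ∑ l ∈ Finset.range (p + 1), t ^ l / l.factorial * pev ((dirDeriv u)^[l] q) x := by
  induction p generalizing q t with
  | zero =>
    have h0 : q.totalDegree = 0 := by omega
    rw [MvPolynomial.totalDegree_eq_zero_iff_eq_C] at h0
    rw [h0]; simp
  | succ p ih =>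
    have hd : (dirDeriv u q).totalDegree ≤ p := (totalDegree_dirDeriv_le u q).trans (by omega)
    set R : ℝ → ℝ := fun t =>
      ∑ l ∈ Finset.range (p + 1 + 1), t ^ l / l.factorial * pev ((dirDeriv u)^[l] q) x with hR
    -- Both sides have the same derivative in `t`, by the induction hypothesis for `dirDeriv u q`,
    -- and agree at `t = 0`.
    have hRd : ∀ t, HasDerivAt R (pev (dirDeriv u q) (x + t • u)) t := by
      intro t
      rw [ih _ hd t]
      have : R = fun t => (∑ l ∈ Finset.range (p + 1),
          t ^ (l + 1) / (l + 1).factorial * pev ((dirDeriv u)^[l] (dirDeriv u q)) x) +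
            pev q x := by
        ext t
        rw [hR]
        simp only
        rw [Finset.sum_range_succ']
        simp
      rw [this]
      refine HasDerivAt.add_const _ (HasDerivAt.fun_sum fun l _ => ?_)
      refine HasDerivAt.mul_const ?_ _
      have h := (hasDerivAt_pow (l + 1) t).div_const ((l + 1).factorial : ℝ)
      refine h.congr_deriv ?_
      rw [Nat.factorial_succ]
      have : (l.factorial : ℝ) ≠ 0 := by positivity
      push_cast
      field_simp
    have key : ∀ s, HasDerivAt (fun t => pev q (x + t • u) - R t) 0 s := fun s => by
      simpa using (hasDerivAt_pev_line q x u s).fun_sub (hRd s)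
    have hc := is_const_of_deriv_eq_zero (fun s => (key s).differentiableAt)
      (fun s => (key s).deriv) t 0
    have hR0 : R 0 = pev q x := by
      rw [hR]; simp only
      rw [Finset.sum_range_succ']
      simp
    simp only [zero_smul, add_zero, hR0, sub_self] at hc
    linarith

/-- Substituting an affine map does not raise the degree. -/
lemma exists_pev_comp_affine {m : ℕ} (f : Vec m →ᵃ[ℝ] Vec n) (q : MvPolynomial (Fin n) ℝ) :
    ∃ q' : MvPolynomial (Fin m) ℝ, q'.totalDegree ≤ q.totalDegree ∧
      ∀ y, pev q' y = pev q (f y) := by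
  let g : Fin n → MvPolynomial (Fin m) ℝ := fun j =>
    MvPolynomial.C (f 0 j) +
      ∑ i, MvPolynomial.C (f.linear (EuclideanSpace.single i 1) j) * MvPolynomial.X i
  have hg : ∀ j, (g j).totalDegree ≤ 1 := fun j => by
    refine (MvPolynomial.totalDegree_add _ _).trans (max_le (by simp) ?_)
    refine MvPolynomial.totalDegree_finsetSum_le fun i _ => ?_
    refine (MvPolynomial.totalDegree_mul _ _).trans ?_
    simp
  have hge : ∀ j y, pev (g j) y = f y j := fun j y => by
    have hy : f y = f.linear y + f 0 := by
      simpa using f.decomp ▸ (by simp)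
    have hy2 : y = ∑ i, y i • EuclideanSpace.single i (1 : ℝ) := by
      ext k; simp [Pi.single_apply]
    rw [hy]
    conv_rhs => rw [hy2]
    simp [g, add_comm, mul_comm]
  refine ⟨MvPolynomial.bind₁ g q, ?_, fun y => ?_⟩
  · rw [MvPolynomial.bind₁, MvPolynomial.aeval_def, MvPolynomial.eval₂_eq]
    refine MvPolynomial.totalDegree_finsetSum_le fun s hs => ?_
    refine (MvPolynomial.totalDegree_mul _ _).trans ?_
    have h1 : (∏ i ∈ s.support, g i ^ s i).totalDegree ≤ ∑ i ∈ s.support, s i :=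
      (MvPolynomial.totalDegree_finsetProd _ _).trans (Finset.sum_le_sum fun i _ =>
        (MvPolynomial.totalDegree_pow _ _).trans (by nlinarith [hg i]))
    have h2 := MvPolynomial.le_totalDegree hs
    simp only [MvPolynomial.algebraMap_eq, MvPolynomial.totalDegree_C, zero_add]
    exact h1.trans h2
  · induction q using MvPolynomial.induction_on with
    | C a => simp
    | add p q hp hq => simp [hp, hq]
    | mul_X p i hp => simp [hp, hge]

/-- A ball contains a product of nondegenerate intervals, and a polynomial vanishing on a product of
infinite sets is zero. -/
lemma eq_zero_of_pev_eq_zero {q : MvPolynomial (Fin n) ℝ} {x₀ : Vec n} {r : ℝ} (hr : 0 < r)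
    (hq : ∀ x ∈ Metric.ball x₀ r, pev q x = 0) : q = 0 := by
  have hcont : Continuous (fun y : Fin n → ℝ => (WithLp.toLp 2 y : Vec n)) :=
    PiLp.continuous_toLp 2 _
  have hnh : (fun y : Fin n → ℝ => (WithLp.toLp 2 y : Vec n)) ⁻¹' (Metric.ball x₀ r) ∈
      𝓝 (x₀.ofLp) := hcont.continuousAt.preimage_mem_nhds (Metric.ball_mem_nhds _ hr)
  obtain ⟨δ, hδ, hsub⟩ := Metric.mem_nhds_iff.1 hnh
  refine MvPolynomial.funext_set (fun i => Ioo (x₀ i - δ) (x₀ i + δ))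
    (fun i => Ioo_infinite (by linarith)) fun y hy => ?_
  have : y ∈ Metric.ball x₀.ofLp δ := by
    rw [Metric.mem_ball, dist_pi_lt_iff hδ]
    intro i
    have := hy i (mem_univ i)
    rw [Real.dist_eq, abs_lt]
    constructor <;> linarith [this.1, this.2]
  simpa [pev] using hq _ (hsub this)

lemma pev_integrableOn (q : MvPolynomial (Fin n) ℝ) {s : Set (Vec n)}
    (hs : Bornology.IsBounded s) : IntegrableOn (fun x => pev q x ^ 2) s :=
  (((continuous_pev q).pow 2).continuousOn.integrableOn_compact
    hs.isCompact_closure).mono_set subset_closure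

lemma setIntegral_sq_pos {q : MvPolynomial (Fin n) ℝ} (hq : q ≠ 0) :
    0 < ∫ x in Metric.closedBall (0 : Vec n) 1, pev q x ^ 2 := by
  have hi : IntegrableOn (fun x => pev q x ^ 2) (Metric.closedBall (0 : Vec n) 1) :=
    (((continuous_pev q).pow 2).continuousOn).integrableOn_compact (isCompact_closedBall 0 1)
  refine (setIntegral_nonneg Metric.isClosed_closedBall.measurableSet
    fun x _ => sq_nonneg _).lt_of_ne fun h0 => hq ?_
  have h1 := (setIntegral_eq_zero_iff_of_nonneg_ae
    (Eventually.of_forall fun x => sq_nonneg _) hi).1 h0.symm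
  have h2 : (fun x => pev q x ^ 2) =ᵐ[volume.restrict (Metric.ball (0 : Vec n) 1)] 0 :=
    ae_restrict_of_ae_restrict_of_subset Metric.ball_subset_closedBall h1
  have h3 := Measure.eqOn_open_of_ae_eq h2 Metric.isOpen_ball
    ((continuous_pev q).pow 2).continuousOn continuousOn_const
  exact eq_zero_of_pev_eq_zero one_pos fun x hx => by simpa using h3 hx

/-- Equivalence of norms on the finite-dimensional space of polynomials, on the unit ball. -/
lemma exists_pev_sq_le_unit (n p : ℕ) (ρ : ℝ)
    (D : MvPolynomial (Fin n) ℝ →ₗ[ℝ] MvPolynomial (Fin n) ℝ) :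
    ∃ C : ℝ, 0 < C ∧ ∀ q : MvPolynomial (Fin n) ℝ, q.totalDegree ≤ p →
      ∀ x : Vec n, ‖x‖ ≤ ρ →
        pev (D q) x ^ 2 ≤ C * ∫ y in Metric.closedBall (0 : Vec n) 1, pev q y ^ 2 := by
  let W := MvPolynomial.restrictTotalDegree (Fin n) ℝ p
  let b := Module.finBasis ℝ W
  let N := Module.finrank ℝ W
  let P : (Fin N → ℝ) → MvPolynomial (Fin n) ℝ := fun a => ∑ i, a i • (b i : MvPolynomial (Fin n) ℝ)
  have hP0 : ∀ a, a ≠ 0 → P a ≠ 0 := by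
    intro a ha h0
    apply ha
    have : ∑ i, a i • b i = 0 := by
      apply Subtype.ext
      simpa [P] using h0
    exact funext fun i => Fintype.linearIndependent_iff.1 b.linearIndependent a this i
  have hPs : ∀ (t : ℝ) a, P (t • a) = t • P a := fun t a => by
    simp [P, Finset.smul_sum, smul_smul]
  have hcontP : Continuous fun z : (Fin N → ℝ) × Vec n => pev (P z.1) z.2 ^ 2 := by
    simp only [P, pev_sum, pev_smul]
    refine Continuous.pow (continuous_finsetSum _ fun i _ => ?_) 2
    exact ((continuous_apply i).comp continuous_fst).mul ((continuous_pev _).comp continuous_snd)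
  have hcontD : Continuous fun z : (Fin N → ℝ) × Vec n => pev (D (P z.1)) z.2 ^ 2 := by
    simp only [P, map_sum, map_smul, pev_sum, pev_smul]
    refine Continuous.pow (continuous_finsetSum _ fun i _ => ?_) 2
    exact ((continuous_apply i).comp continuous_fst).mul ((continuous_pev _).comp continuous_snd)
  have hG : Continuous fun a : Fin N → ℝ =>
      ∫ y in Metric.closedBall (0 : Vec n) 1, pev (P a) y ^ 2 :=
    continuous_parametric_integral_of_continuous hcontP (isCompact_closedBall 0 1)
  -- The `L²` norm has a positive minimum on the unit sphere of coefficients. Both sides are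
  -- quadratic in the coefficients, so it suffices to compare them on that sphere.
  obtain ⟨m, hm, hmle⟩ := (isCompact_sphere (0 : Fin N → ℝ) 1).exists_forall_le' (a := 0)
    hG.continuousOn (fun a ha => setIntegral_sq_pos (hP0 a fun h => by simp [h] at ha))
  obtain ⟨B, hB⟩ := ((isCompact_sphere (0 : Fin N → ℝ) 1).prod
    (isCompact_closedBall (0 : Vec n) ρ)).exists_bound_of_continuousOn hcontD.continuousOn
  -- The summand `1` keeps the constant positive even if `B = 0`.
  refine ⟨(|B| + 1) / m, by positivity, fun q hq x hx => ?_⟩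
  obtain ⟨a, rfl⟩ : ∃ a, P a = q := by
    refine ⟨b.repr ⟨q, (MvPolynomial.mem_restrictTotalDegree _ _ _).2 hq⟩, ?_⟩
    have := congrArg Subtype.val (b.sum_repr ⟨q, (MvPolynomial.mem_restrictTotalDegree _ _ _).2 hq⟩)
    rw [← Submodule.subtype_apply, map_sum] at this
    simpa only [map_smul, Submodule.subtype_apply] using this
  rcases eq_or_ne a 0 with rfl | ha
  · have : P 0 = 0 := by simp [P]
    simp [this]
  have hn : ‖a‖ ≠ 0 := by simpa using ha
  have hs : ‖a‖⁻¹ • a ∈ Metric.sphere (0 : Fin N → ℝ) 1 := by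
    simp [norm_smul, hn]
  have e : a = ‖a‖ • (‖a‖⁻¹ • a) := by rw [smul_smul, mul_inv_cancel₀ hn, one_smul]
  have h1 := hmle _ hs
  have h2 := hB (‖a‖⁻¹ • a, x) ⟨hs, by simpa using hx⟩
  simp only [Real.norm_eq_abs] at h2
  generalize ‖a‖⁻¹ • a = a' at *
  generalize ‖a‖ = t at *
  subst e
  simp only [hPs, map_smul, pev_smul, mul_pow, integral_const_mul]
  have h3 : pev (D (P a')) x ^ 2 ≤ |B| + 1 := by
    have := le_abs_self (pev (D (P a')) x ^ 2)
    have := le_abs_self B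
    linarith
  have h4 : |B| + 1 ≤ (|B| + 1) / m * ∫ y in Metric.closedBall (0 : Vec n) 1, pev (P a') y ^ 2 := by
    rw [div_mul_eq_mul_div, le_div_iff₀ hm]
    gcongr
  exact (mul_le_mul_of_nonneg_left (h3.trans h4) (sq_nonneg t)).trans (le_of_eq (by ring))

lemma pev_pderiv_comp_smul (q q' : MvPolynomial (Fin n) ℝ) (x₀ : Vec n) (r : ℝ)
    (h : ∀ y, pev q' y = pev q (x₀ + r • y)) (j : Fin n) (y : Vec n) :
    pev (MvPolynomial.pderiv j q') y = r * pev (MvPolynomial.pderiv j q) (x₀ + r • y) := by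
  rw [← fderiv_pev_single, ← fderiv_pev_single]
  have e : pev q' = pev q ∘ fun y => x₀ + r • y := funext h
  have h1 : HasFDerivAt (fun y : Vec n => x₀ + r • y) (r • ContinuousLinearMap.id ℝ (Vec n)) y :=
    ((hasFDerivAt_id y).const_smul r).const_add x₀
  have h2 := ((contDiff_pev q (k := 1)).differentiable (by simp) (x₀ + r • y)).hasFDerivAt
  rw [e, (h2.comp y h1).fderiv]
  simp

/-- The unit-ball estimate rescaled by `y ↦ x₀ + r • y`: the volume gives `r ^ n`, each derivative
gives `r⁻¹`. The point `x` may lie outside the ball, which allows extrapolation from one element to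
another. -/
lemma exists_pev_sq_le (n p : ℕ) (ρ : ℝ) :
    ∃ C : ℝ, 0 < C ∧ ∀ q : MvPolynomial (Fin n) ℝ, q.totalDegree ≤ p →
      ∀ (x₀ : Vec n) (r : ℝ), 0 < r → ∀ x : Vec n, dist x x₀ ≤ ρ * r →
        pev q x ^ 2 * r ^ n ≤ C * (∫ y in Metric.closedBall x₀ r, pev q y ^ 2) ∧
        ∀ j, pev (MvPolynomial.pderiv j q) x ^ 2 * r ^ n ≤
          C * (r ^ 2)⁻¹ * (∫ y in Metric.closedBall x₀ r, pev q y ^ 2) := by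
  obtain ⟨C₀, hC₀, H₀⟩ := exists_pev_sq_le_unit n p ρ LinearMap.id
  choose C₁ hC₁ H₁ using fun j => exists_pev_sq_le_unit n p ρ
    ((MvPolynomial.pderiv j : Derivation ℝ _ _).toLinearMap)
  refine ⟨C₀ + ∑ j, C₁ j, add_pos_of_pos_of_nonneg hC₀ (Finset.sum_nonneg fun j _ => (hC₁ j).le),
    fun q hq x₀ r hr x hx => ?_⟩
  obtain ⟨q', hq', hqe⟩ := exists_pev_comp_affine
    (AffineMap.const ℝ (Vec n) x₀ + r • AffineMap.id ℝ (Vec n)) q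
  replace hqe : ∀ y, pev q' y = pev q (x₀ + r • y) := by simpa using hqe
  obtain ⟨y, rfl⟩ : ∃ y, x = x₀ + r • y :=
    ⟨r⁻¹ • (x - x₀), by rw [smul_smul, mul_inv_cancel₀ hr.ne']; simp⟩
  have hy : ‖y‖ ≤ ρ := by
    rw [dist_eq_norm, add_sub_cancel_left, norm_smul, Real.norm_of_nonneg hr.le, mul_comm] at hx
    exact le_of_mul_le_mul_right hx hr
  have hint : ∫ y in Metric.closedBall x₀ r, pev q y ^ 2 =
      r ^ n * ∫ y in Metric.closedBall (0 : Vec n) 1, pev q' y ^ 2 := by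
    have h1 := Measure.setIntegral_comp_smul_of_pos volume
      (fun z : Vec n => pev q (x₀ + z) ^ 2) (Metric.closedBall (0 : Vec n) 1) hr
    simp only [hqe]
    rw [h1, smul_closedBall _ _ zero_le_one]
    simp only [finrank_euclideanSpace, Fintype.card_fin, smul_eq_mul, smul_zero, mul_one,
      Real.norm_of_nonneg hr.le]
    rw [mul_inv_cancel_left₀ (by positivity)]
    have h2 := (measurePreserving_add_left (volume : Measure (Vec n)) x₀).setIntegral_preimage_emb
      (measurableEmbedding_addLeft x₀) (fun z => pev q z ^ 2) (Metric.closedBall x₀ r)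
    rw [← h2]
    congr 2
    ext z; simp
  have hI : 0 ≤ ∫ y in Metric.closedBall (0 : Vec n) 1, pev q' y ^ 2 :=
    setIntegral_nonneg Metric.isClosed_closedBall.measurableSet fun _ _ => sq_nonneg _
  have hrn : 0 < r ^ n := by positivity
  refine ⟨?_, fun j => ?_⟩
  · have h := H₀ q' (hq'.trans hq) y hy
    simp only [LinearMap.id_apply, hqe y] at h
    have hs : 0 ≤ ∑ j, C₁ j := Finset.sum_nonneg fun j _ => (hC₁ j).le
    rw [hint]
    nlinarith [mul_le_mul_of_nonneg_left h hrn.le, mul_nonneg hs (mul_nonneg hrn.le hI)]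
  · have h := H₁ j q' (hq'.trans hq) y hy
    simp only [Derivation.coeFn_coe, pev_pderiv_comp_smul q q' x₀ r hqe j y] at h
    have hs : C₁ j ≤ C₀ + ∑ j, C₁ j := by
      have := Finset.single_le_sum (f := C₁) (fun j _ => (hC₁ j).le) (Finset.mem_univ j)
      linarith
    have h5 := h.trans (mul_le_mul_of_nonneg_right hs hI)
    rw [hint]
    have : pev (MvPolynomial.pderiv j q) (x₀ + r • y) ^ 2 * r ^ n =
      (r ^ 2)⁻¹ * r ^ n * (r * pev (MvPolynomial.pderiv j q) (x₀ + r • y)) ^ 2 := by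
      field_simp
    rw [this]
    exact (mul_le_mul_of_nonneg_left h5 (by positivity)).trans (le_of_eq (by ring))

end Poly

/-! ### Normal derivatives of polynomials and jumps across a face -/

/-- The polynomial vector field with components `q`. -/
def pmap {n : ℕ} (q : Fin n → MvPolynomial (Fin n) ℝ) (x : Vec n) : Vec n :=
  WithLp.toLp 2 fun i => pev (q i) x

lemma contDiff_pmap {n : ℕ} (q : Fin n → MvPolynomial (Fin n) ℝ) {k : WithTop ℕ∞} :
    ContDiff ℝ k (pmap q) :=
  contDiff_piLp _ |>.2 fun i => contDiff_pev (q i)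

lemma iteratedFDeriv_pev {n : ℕ} (q : MvPolynomial (Fin n) ℝ) (u : Vec n) (l : ℕ) (x : Vec n) :
    iteratedFDeriv ℝ l (pev q) x (fun _ => u) = pev ((dirDeriv u)^[l] q) x := by
  induction l generalizing x with
  | zero => simp
  | succ l ih =>
    have hd : DifferentiableAt ℝ (iteratedFDeriv ℝ l (pev q)) x :=
      (contDiff_pev q (k := (⊤ : ℕ∞))).differentiable_iteratedFDeriv
        (by exact_mod_cast ENat.natCast_lt_top l) x
    rw [iteratedFDeriv_succ_apply_left, Function.iterate_succ_apply', ← fderiv_pev_eq_dirDeriv]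
    have e : pev ((dirDeriv u)^[l] q) = fun x => iteratedFDeriv ℝ l (pev q) x (fun _ => u) :=
      funext fun x => (ih x).symm
    rw [e, fderiv_continuousMultilinear_apply_const_apply hd]
    rfl

lemma iteratedFDeriv_pmap {n : ℕ} (q : Fin n → MvPolynomial (Fin n) ℝ) (u : Vec n) (l : ℕ)
    (x : Vec n) (i : Fin n) :
    iteratedFDeriv ℝ l (pmap q) x (fun _ => u) i = pev ((dirDeriv u)^[l] (q i)) x := by
  rw [← iteratedFDeriv_pev]
  have e : pev (q i) = (EuclideanSpace.proj i : Vec n →L[ℝ] ℝ) ∘ pmap q := by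
    ext x; simp [pmap]
  rw [e, ContinuousLinearMap.iteratedFDeriv_comp_left _ (contDiff_pmap q (k := l)).contDiffAt
    le_rfl]
  simp

/-- A convex set with nonempty interior has unique derivatives up to its boundary, so on the face
each one-sided derivative is that of the polynomial representing `v` on that element. -/
lemma jump_apply {n : ℕ} {K₁ K₂ : Set (Vec n)} (hc₁ : Convex ℝ K₁) (hc₂ : Convex ℝ K₂)
    (hi₁ : (interior K₁).Nonempty) (hi₂ : (interior K₂).Nonempty)
    {q₁ q₂ : Fin n → MvPolynomial (Fin n) ℝ} {v : Vec n → Vec n}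
    (hv₁ : EqOn v (pmap q₁) K₁) (hv₂ : EqOn v (pmap q₂) K₂) (l : ℕ) {x : Vec n}
    (hx : x ∈ K₁ ∩ K₂) (i : Fin n) :
    jump l K₁ K₂ v x i = pev ((dirDeriv (faceNormal (K₁ ∩ K₂)))^[l] (q₁ i - q₂ i)) x := by
  have h : ∀ {K : Set (Vec n)} {q : Fin n → MvPolynomial (Fin n) ℝ} (_ : Convex ℝ K)
      (_ : (interior K).Nonempty) (_ : EqOn v (pmap q) K) (_ : x ∈ K) (u : Vec n),
      iteratedFDerivWithin ℝ l v K x (fun _ => u) i = pev ((dirDeriv u)^[l] (q i)) x := by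
    intro K q hc hi hv hx u
    rw [iteratedFDerivWithin_congr hv hx, iteratedFDerivWithin_eq_iteratedFDeriv
      (uniqueDiffOn_convex hc hi) (contDiff_pmap q).contDiffAt hx, iteratedFDeriv_pmap]
  rw [jump, PiLp.sub_apply, h hc₁ hi₁ hv₁ hx.1, h hc₂ hi₂ hv₂ hx.2, iterate_map_sub, pev_sub]

section Face

variable {m : ℕ}

/-- The direction of `F` has codimension one, so its orthogonal complement is a line. Hence a normal
exists and the default value `0` of `faceNormal` does not occur. -/
lemma faceNormal_spec {F : Set (Vec (m + 1))} (hF : Module.finrank ℝ (vectorSpan ℝ F) = m) :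
    ‖faceNormal F‖ = 1 ∧ vectorSpan ℝ F = (Submodule.span ℝ {faceNormal F})ᗮ := by
  have hn : ∃ n : Vec (m + 1), ‖n‖ = 1 ∧ ∀ x ∈ F, ∀ y ∈ F, inner ℝ n (x - y) = 0 := by
    have hfr := Submodule.finrank_add_finrank_orthogonal (vectorSpan ℝ F)
    rw [hF, finrank_euclideanSpace, Fintype.card_fin] at hfr
    have : 0 < Module.finrank ℝ (vectorSpan ℝ F)ᗮ := by omega
    obtain ⟨w, hw⟩ := (Module.finrank_pos_iff_exists_ne_zero).1 this
    have hw0 : (w : Vec (m + 1)) ≠ 0 := fun h => hw (Subtype.ext h)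
    refine ⟨(‖(w : Vec (m + 1))‖⁻¹ : ℝ) • (w : Vec (m + 1)), ?_, fun x hx y hy => ?_⟩
    · rw [norm_smul, norm_inv, norm_norm, inv_mul_cancel₀ (norm_ne_zero_iff.2 hw0)]
    · have := Submodule.inner_left_of_mem_orthogonal (vsub_mem_vectorSpan ℝ hx hy) w.2
      rw [vsub_eq_sub] at this
      rw [inner_smul_left, this, mul_zero]
  have hs : ‖faceNormal F‖ = 1 ∧ ∀ x ∈ F, ∀ y ∈ F, inner ℝ (faceNormal F) (x - y) = 0 := by
    rw [faceNormal, dif_pos hn]; exact hn.choose_spec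
  refine ⟨hs.1, ?_⟩
  have hle : vectorSpan ℝ F ≤ (Submodule.span ℝ {faceNormal F})ᗮ := by
    rw [vectorSpan, Submodule.span_le]
    rintro _ ⟨x, hx, y, hy, rfl⟩
    rw [SetLike.mem_coe, Submodule.mem_orthogonal_singleton_iff_inner_right]
    exact hs.2 x hx y hy
  refine Submodule.eq_of_le_of_finrank_eq hle ?_
  have hne : faceNormal F ≠ 0 := fun h => by simp [h] at hs
  have h1 := Submodule.finrank_add_finrank_orthogonal (Submodule.span ℝ {faceNormal F})
  rw [finrank_span_singleton hne, finrank_euclideanSpace, Fintype.card_fin] at h1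
  omega

/-- An isometric parametrization of the hyperplane containing a face. -/
lemma exists_face_isometry {F : Set (Vec (m + 1))}
    (hF : Module.finrank ℝ (vectorSpan ℝ F) = m) {c : Vec (m + 1)} (hc : c ∈ F) :
    ∃ A : Vec m →ₗᵢ[ℝ] Vec (m + 1), (∀ x ∈ F, ∃ y, x = c + A y) ∧
      (∀ y, c + A y ∈ affineSpan ℝ F) ∧
      ∀ x, ∃ (y : Vec m) (t : ℝ), x = c + A y + t • faceNormal F ∧
        ‖y‖ ≤ 2 * dist x c ∧ |t| ≤ dist x c := by
  obtain ⟨hn, hV⟩ := faceNormal_spec hF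
  let e := ((stdOrthonormalBasis ℝ (vectorSpan ℝ F)).reindex (finCongr hF)).repr.symm
  let A : Vec m →ₗᵢ[ℝ] Vec (m + 1) := (vectorSpan ℝ F).subtypeₗᵢ.comp e.toLinearIsometry
  have hA : ∀ w ∈ vectorSpan ℝ F, ∃ y, A y = w := fun w hw =>
    ⟨e.symm ⟨w, hw⟩, by simp [A]⟩
  refine ⟨A, fun x hx => ?_, fun y => ?_, fun x => ?_⟩
  · obtain ⟨y, hy⟩ := hA _ (vsub_mem_vectorSpan ℝ hx hc)
    exact ⟨y, by rw [hy]; simp⟩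
  · rw [add_comm c (A y)]
    refine AffineSubspace.vadd_mem_of_mem_direction ?_ (mem_affineSpan ℝ hc)
    rw [direction_affineSpan]
    exact (e y).2
  · have ht : |inner ℝ (faceNormal F) (x - c)| ≤ dist x c := by
      refine (abs_real_inner_le_norm _ _).trans ?_
      rw [hn, one_mul, dist_eq_norm]
    obtain ⟨y, hy⟩ := hA (x - c - inner ℝ (faceNormal F) (x - c) • faceNormal F) (by
      rw [hV, Submodule.mem_orthogonal_singleton_iff_inner_right, inner_sub_right,
        inner_smul_right, real_inner_self_eq_norm_sq, hn]
      ring)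
    refine ⟨y, _, by rw [hy]; abel, ?_, ht⟩
    rw [← A.norm_map y, hy]
    refine (norm_sub_le _ _).trans ?_
    rw [norm_smul, hn, Real.norm_eq_abs, ← dist_eq_norm]
    linarith

/-- The measure `μHE[m]` is preserved by isometries and is Lebesgue measure on `Vec m`; face
integrals thus become volume integrals, to which `exists_pev_sq_le` applies in dimension `m`. -/
lemma setIntegral_face {F : Set (Vec (m + 1))} (hFm : MeasurableSet F) {c : Vec (m + 1)}
    (A : Vec m →ₗᵢ[ℝ] Vec (m + 1)) (hA : ∀ x ∈ F, ∃ y, x = c + A y) (g : Vec (m + 1) → ℝ) :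
    ∫ x in F, g x ∂μHE[m] = ∫ y in (fun y => c + A y) ⁻¹' F, g (c + A y) := by
  have hiso : Isometry fun y => c + A y := (isometry_add_left c).comp A.isometry
  have hemb : MeasurableEmbedding fun y => c + A y :=
    hiso.isClosedEmbedding.measurableEmbedding
  have h1 := hiso.map_euclideanHausdorffMeasure (d := m)
  have h2 := hemb.setIntegral_map (μ := volume) g F
  rw [← h2, ← EuclideanSpace.euclideanHausdorffMeasure_eq_volume, h1,
    Measure.restrict_restrict hFm]
  congr 2
  rw [inter_eq_left.2]
  intro x hx
  obtain ⟨y, rfl⟩ := hA x hx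
  exact ⟨y, rfl⟩

/-- The difference of the two polynomials on both sides of a face is controlled by the jumps of
the normal derivatives. -/
lemma exists_face_bound (m p : ℕ) {κ ρ : ℝ} (hκ : 0 < κ) (hρ : 1 ≤ ρ) :
    ∃ C : ℝ, 0 < C ∧ ∀ h : ℝ, 0 < h → ∀ K₁ K₂ : Set (Vec (m + 1)), Convex ℝ K₁ → Convex ℝ K₂ →
      IsCompact K₁ → IsCompact K₂ → (interior K₁).Nonempty → (interior K₂).Nonempty →
      ShareFace K₁ K₂ → ∀ c ∈ K₁ ∩ K₂,
      Metric.closedBall c (h / κ) ∩ affineSpan ℝ (K₁ ∩ K₂) ⊆ K₁ ∩ K₂ →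
      ∀ (v : Vec (m + 1) → Vec (m + 1)) (q₁ q₂ : Fin (m + 1) → MvPolynomial (Fin (m + 1)) ℝ),
      (∀ i, (q₁ i).totalDegree ≤ p) → (∀ i, (q₂ i).totalDegree ≤ p) →
      EqOn v (pmap q₁) K₁ → EqOn v (pmap q₂) K₂ → ∀ (i : Fin (m + 1)) (x : Vec (m + 1)),
      dist x c ≤ ρ * h →
      pev (q₁ i - q₂ i) x ^ 2 * h ^ (m + 1) ≤ C * ∑ l ∈ Finset.Icc 1 p, h ^ (2 * l + 1) *
        ∫ x in K₁ ∩ K₂, inner ℝ (jump l K₁ K₂ v x) (jump l K₁ K₂ v x) ∂μHE[m] := by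
  obtain ⟨C, hC, H⟩ := exists_pev_sq_le m p (2 * ρ * κ)
  -- The factor `p` comes from Cauchy–Schwarz over the Taylor terms, raised to `p + 1` so that `p =
  -- 0` still gives a positive constant; `ρ ^ (2 * p)` bounds powers of the normal distance, and `κ
  -- ^ m` converts the disc radius `h / κ` to `h`.
  refine ⟨(p + 1) * ρ ^ (2 * p) * κ ^ m * C, by positivity, ?_⟩
  intro h hh K₁ K₂ hc₁ hc₂ hk₁ hk₂ hi₁ hi₂ hsh c hc hdisc v q₁ q₂ hq₁ hq₂ hv₁ hv₂ i x hx
  have hF : Module.finrank ℝ (vectorSpan ℝ (K₁ ∩ K₂)) = m := by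
    have := hsh; unfold ShareFace at this; omega
  obtain ⟨hn, -⟩ := faceNormal_spec hF
  obtain ⟨A, hA1, hA2, hA3⟩ := exists_face_isometry hF hc
  set n := faceNormal (K₁ ∩ K₂) with hndef
  set q := q₁ i - q₂ i with hqdef
  have hq : q.totalDegree ≤ p :=
    (MvPolynomial.totalDegree_sub _ _).trans (max_le (hq₁ i) (hq₂ i))
  have hFm : MeasurableSet (K₁ ∩ K₂) := (hk₁.inter hk₂).isClosed.measurableSet
  have hcontφ : Continuous fun y => c + A y := continuous_const.add A.continuous
  have hFc : IsCompact ((fun y => c + A y) ⁻¹' (K₁ ∩ K₂)) :=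
    ((isometry_add_left c).comp A.isometry).isClosedEmbedding.isCompact_preimage (hk₁.inter hk₂)
  have hball : Metric.closedBall (0 : Vec m) (h / κ) ⊆ (fun y => c + A y) ⁻¹' (K₁ ∩ K₂) := by
    intro y hy
    refine hdisc ⟨?_, hA2 y⟩
    simpa using hy
  choose g hg hge using fun l => exists_pev_comp_affine
    (AffineMap.const ℝ (Vec m) c + A.toLinearMap.toAffineMap) ((dirDeriv n)^[l] q)
  replace hge : ∀ l y, pev (g l) y = pev ((dirDeriv n)^[l] q) (c + A y) := fun l y => by
    simpa using hge l y
  have hgd : ∀ l, (g l).totalDegree ≤ p := fun l =>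
    (hg l).trans ((totalDegree_iterate_dirDeriv_le n q l).trans hq)
  -- This is where continuity of `v` enters: both polynomials equal `v` on the face, so the term of
  -- order zero is absent. It vanishes on the whole hyperplane because it vanishes on a disc.
  have hg0 : g 0 = 0 := by
    refine eq_zero_of_pev_eq_zero (x₀ := 0) (div_pos hh hκ) fun y hy => ?_
    have hy' := hball (Metric.ball_subset_closedBall hy)
    have e1 := congrArg (· i) (hv₁ hy'.1)
    have e2 := congrArg (· i) (hv₂ hy'.2)
    simp only [pmap] at e1 e2
    rw [hge, Function.iterate_zero, id, hqdef, pev_sub, ← e1, ← e2, sub_self]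
  set J : ℕ → ℝ := fun l =>
    ∫ x in K₁ ∩ K₂, inner ℝ (jump l K₁ K₂ v x) (jump l K₁ K₂ v x) ∂μHE[m] with hJ
  have hgJ : ∀ l, ∫ y in Metric.closedBall (0 : Vec m) (h / κ), pev (g l) y ^ 2 ≤ J l := by
    intro l
    have e : ∀ y ∈ (fun y => c + A y) ⁻¹' (K₁ ∩ K₂),
        inner ℝ (jump l K₁ K₂ v (c + A y)) (jump l K₁ K₂ v (c + A y)) =
          ∑ k, pev ((dirDeriv n)^[l] (q₁ k - q₂ k)) (c + A y) ^ 2 := by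
      intro y hy
      rw [PiLp.inner_apply]
      refine Finset.sum_congr rfl fun k _ => ?_
      rw [jump_apply hc₁ hc₂ hi₁ hi₂ hv₁ hv₂ l hy k]
      simp [sq, hndef]
    have hcont : Continuous fun y =>
        ∑ k, pev ((dirDeriv n)^[l] (q₁ k - q₂ k)) (c + A y) ^ 2 :=
      continuous_finsetSum _ fun k _ => ((continuous_pev _).comp hcontφ).pow 2
    rw [hJ]
    simp only
    rw [setIntegral_face hFm A hA1, setIntegral_congr_fun hFc.isClosed.measurableSet e]
    have hint := hcont.continuousOn.integrableOn_compact (μ := volume) hFc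
    calc _ ≤ ∫ y in Metric.closedBall (0 : Vec m) (h / κ),
          ∑ k, pev ((dirDeriv n)^[l] (q₁ k - q₂ k)) (c + A y) ^ 2 := by
          refine setIntegral_mono ?_ (hint.mono_set hball) fun y => ?_
          · exact pev_integrableOn _ Metric.isBounded_closedBall
          · simp only [hge]
            exact Finset.single_le_sum
              (f := fun k => pev ((dirDeriv n)^[l] (q₁ k - q₂ k)) (c + A y) ^ 2)
              (fun k _ => sq_nonneg _) (Finset.mem_univ i)
      _ ≤ _ := setIntegral_mono_set hint
          (Eventually.of_forall fun y => Finset.sum_nonneg fun k _ => sq_nonneg _)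
          (LE.le.eventuallyLE hball)
  obtain ⟨y, t, rfl, hy, ht⟩ := hA3 x
  have hρ0 : 0 < ρ := by linarith
  have ht' : |t| ≤ ρ * h := ht.trans hx
  have hy' : dist y 0 ≤ 2 * ρ * κ * (h / κ) := by
    rw [dist_zero_right, mul_assoc (2 * ρ), mul_div_cancel₀ _ hκ.ne']; linarith
  have hb : ∀ l, pev (g l) y ^ 2 * h ^ m ≤ κ ^ m * C * J l := by
    intro l
    have h1 := (H (g l) (hgd l) 0 (h / κ) (by positivity) y hy').1
    rw [div_pow, mul_div_assoc', div_le_iff₀ (by positivity)] at h1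
    refine h1.trans ?_
    rw [mul_comm _ (κ ^ m), mul_assoc]
    gcongr
    exact hgJ l
  rw [pev_add_smul p q hq]
  have hr : Finset.range (p + 1) = insert 0 (Finset.Icc 1 p) := by ext; simp; omega
  have hz : pev ((dirDeriv n)^[0] q) (c + A y) = 0 := by rw [← hge, hg0, pev_zero]
  rw [hr, Finset.sum_insert (by simp), hz, mul_zero, zero_add]
  have hsq := sq_sum_le_card_mul_sum_sq (s := Finset.Icc 1 p)
    (f := fun l => t ^ l / (l.factorial : ℝ) * pev ((dirDeriv n)^[l] q) (c + A y))
  simp only [Nat.card_Icc, add_tsub_cancel_right] at hsq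
  have hterm : ∀ l ∈ Finset.Icc 1 p,
      (t ^ l / (l.factorial : ℝ) * pev ((dirDeriv n)^[l] q) (c + A y)) ^ 2 * h ^ (m + 1) ≤
        ρ ^ (2 * p) * κ ^ m * C * (h ^ (2 * l + 1) * J l) := by
    intro l hl
    have hlp : l ≤ p := (Finset.mem_Icc.1 hl).2
    rw [← hge]
    have h1 : (t ^ l / (l.factorial : ℝ)) ^ 2 ≤ ρ ^ (2 * p) * h ^ (2 * l) := by
      have h2 : |t ^ l / (l.factorial : ℝ)| ≤ (ρ * h) ^ l := by
        rw [abs_div, abs_pow, Nat.abs_cast]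
        refine (div_le_self (by positivity) (by exact_mod_cast Nat.factorial_pos l)).trans ?_
        gcongr
      calc (t ^ l / (l.factorial : ℝ)) ^ 2 = |t ^ l / (l.factorial : ℝ)| ^ 2 := (sq_abs _).symm
        _ ≤ ((ρ * h) ^ l) ^ 2 := by gcongr
        _ = ρ ^ (2 * l) * h ^ (2 * l) := by ring
        _ ≤ _ := by gcongr
    calc _ = (t ^ l / (l.factorial : ℝ)) ^ 2 * h * (pev (g l) y ^ 2 * h ^ m) := by ring
      _ ≤ (ρ ^ (2 * p) * h ^ (2 * l)) * h * (κ ^ m * C * J l) := by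
          exact mul_le_mul (mul_le_mul_of_nonneg_right h1 hh.le) (hb l) (by positivity)
            (by positivity)
      _ = _ := by ring
  have hJ0 : 0 ≤ ∑ l ∈ Finset.Icc 1 p, h ^ (2 * l + 1) * J l :=
    Finset.sum_nonneg fun l _ => mul_nonneg (by positivity)
      (integral_nonneg fun x => real_inner_self_nonneg)
  calc _ ≤ ((p : ℝ) * ∑ l ∈ Finset.Icc 1 p,
        (t ^ l / (l.factorial : ℝ) * pev ((dirDeriv n)^[l] q) (c + A y)) ^ 2) * h ^ (m + 1) := by
        gcongr
    _ = p * ∑ l ∈ Finset.Icc 1 p,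
        (t ^ l / (l.factorial : ℝ) * pev ((dirDeriv n)^[l] q) (c + A y)) ^ 2 * h ^ (m + 1) := by
        rw [mul_assoc, Finset.sum_mul]
    _ ≤ p * ∑ l ∈ Finset.Icc 1 p, ρ ^ (2 * p) * κ ^ m * C * (h ^ (2 * l + 1) * J l) := by
        exact mul_le_mul_of_nonneg_left (Finset.sum_le_sum hterm) (Nat.cast_nonneg p)
    _ ≤ (p + 1) * ∑ l ∈ Finset.Icc 1 p, ρ ^ (2 * p) * κ ^ m * C * (h ^ (2 * l + 1) * J l) := by
        rw [← Finset.mul_sum]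
        gcongr
        linarith
    _ = _ := by rw [← Finset.mul_sum]; ring

end Face

section Geometry

variable {m : ℕ}

/-! ### The uniform interior cone condition -/

/-- A step `t` along `e` raises the height above the graph by `t`, while a perturbation `u` lowers
it by at most `(1 + L) * ‖u‖`; hence the aperture `1 / (1 + L)`. Near interior points any direction
works. -/
lemma exists_cone_local {Ω : Set (Vec (m + 1))} (hΩ : IsLipschitzDomain Ω) {x₀ : Vec (m + 1)}
    (hx₀ : x₀ ∈ closure Ω) : ∃ r : ℝ, 0 < r ∧ ∃ c T : ℝ, 0 < c ∧ c ≤ 1 ∧ 0 < T ∧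
      ∀ x ∈ Metric.ball x₀ r ∩ Ω, ∃ e : Vec (m + 1), ‖e‖ = 1 ∧ ∀ t, 0 < t → t ≤ T →
        Metric.ball (x + t • e) (c * t) ⊆ Ω := by
  have hdist : ∀ {r t c : ℝ} {x e y : Vec (m + 1)}, 0 < r → c ≤ 1 → ‖e‖ = 1 → 0 < t → t ≤ r / 4 →
      x ∈ Metric.ball x₀ (r / 2) → y ∈ Metric.ball (x + t • e) (c * t) →
      y ∈ Metric.ball x₀ r := by
    intro r t c x e y hr hc he ht htr hx hy
    rw [Metric.mem_ball] at *
    have h1 : dist (x + t • e) x = t := by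
      rw [dist_eq_norm, add_sub_cancel_left, norm_smul, he, mul_one, Real.norm_of_nonneg ht.le]
    have h2 : c * t ≤ t := by nlinarith
    linarith [dist_triangle y (x + t • e) x₀, dist_triangle (x + t • e) x x₀]
  by_cases hx : x₀ ∈ Ω
  · obtain ⟨r, hr, hsub⟩ := Metric.isOpen_iff.1 hΩ.isOpen x₀ hx
    refine ⟨r / 2, by positivity, 1, r / 4, one_pos, le_rfl, by positivity, fun x hx => ?_⟩
    have he : ‖(EuclideanSpace.single 0 1 : Vec (m + 1))‖ = 1 := by simp
    exact ⟨_, he, fun t ht htr y hy => hsub (hdist hr le_rfl he ht htr hx.1 hy)⟩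
  · have hf : x₀ ∈ frontier Ω := ⟨hx₀, fun h => hx (interior_subset h)⟩
    obtain ⟨e, he, r, hr, L, φ, hφ, hΩφ⟩ := hΩ.lipschitz_boundary x₀ hf
    have hc1 : 1 / (1 + (L : ℝ)) ≤ 1 := by
      rw [div_le_one (by positivity)]; linarith [L.coe_nonneg]
    refine ⟨r / 2, by positivity, 1 / (1 + L), r / 4, by positivity, hc1, by positivity,
      fun x hx => ⟨e, he, fun t ht htr y hy => ?_⟩⟩
    rw [hΩφ y (hdist hr hc1 he ht htr hx.1 hy)]
    have hxφ := (hΩφ x (Metric.ball_subset_ball (by linarith) hx.1)).1 hx.2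
    set u := y - (x + t • e) with hu
    have hun : ‖u‖ < 1 / (1 + (L : ℝ)) * t := by rw [← dist_eq_norm]; exact hy
    have hy' : y = x + t • e + u := by rw [hu]; abel
    have hee : inner ℝ e e = (1 : ℝ) := by rw [real_inner_self_eq_norm_sq, he]; norm_num
    have hiy : inner ℝ e y = inner ℝ e x + t + inner ℝ e u := by
      rw [hy', inner_add_right, inner_add_right, inner_smul_right, hee, mul_one]
    have hie : |inner ℝ e u| ≤ ‖u‖ := by
      simpa [he] using abs_real_inner_le_norm e u
    have hproj : ‖u - inner ℝ e u • e‖ ≤ ‖u‖ := by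
      have : ‖u - inner ℝ e u • e‖ ^ 2 ≤ ‖u‖ ^ 2 := by
        rw [norm_sub_sq_real, inner_smul_right, norm_smul, he, real_inner_comm e u,
          Real.norm_eq_abs, mul_one, sq_abs]
        nlinarith [sq_nonneg (inner ℝ e u)]
      exact (pow_le_pow_iff_left₀ (norm_nonneg _) (norm_nonneg _) two_ne_zero).1 this
    have hperp : (y - inner ℝ e y • e) - (x - inner ℝ e x • e) = u - inner ℝ e u • e := by
      rw [hiy]; nth_rw 1 [hy']; module
    have hL := hφ.dist_le_mul (y - inner ℝ e y • e) (x - inner ℝ e x • e)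
    rw [dist_eq_norm (y - _), hperp, Real.dist_eq] at hL
    have hL' := (le_abs_self _).trans (hL.trans (mul_le_mul_of_nonneg_left hproj L.coe_nonneg))
    have hkey : (1 + (L : ℝ)) * ‖u‖ < t := by
      rw [div_mul_eq_mul_div, one_mul, lt_div_iff₀ (by positivity)] at hun
      linarith
    linarith [neg_abs_le (inner ℝ e u)]

/-- Compactness of the closure makes the local constants uniform, since the cone property survives
decreasing `c` and `T`. -/
lemma IsLipschitzDomain.exists_cone {Ω : Set (Vec (m + 1))} (hΩ : IsLipschitzDomain Ω) :
    ∃ c T : ℝ, 0 < c ∧ c ≤ 1 ∧ 0 < T ∧ ∀ x ∈ Ω, ∃ e : Vec (m + 1), ‖e‖ = 1 ∧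
      ∀ t, 0 < t → t ≤ T → Metric.ball (x + t • e) (c * t) ⊆ Ω := by
  have hcpt : IsCompact (closure Ω) := hΩ.isBounded.isCompact_closure
  have key : ∃ c T : ℝ, 0 < c ∧ c ≤ 1 ∧ 0 < T ∧ ∀ x ∈ closure Ω ∩ Ω, ∃ e : Vec (m + 1), ‖e‖ = 1 ∧
      ∀ t, 0 < t → t ≤ T → Metric.ball (x + t • e) (c * t) ⊆ Ω := by
    refine hcpt.induction_on (p := fun S => ∃ c T : ℝ, 0 < c ∧ c ≤ 1 ∧ 0 < T ∧ ∀ x ∈ S ∩ Ω,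
      ∃ e : Vec (m + 1), ‖e‖ = 1 ∧ ∀ t, 0 < t → t ≤ T → Metric.ball (x + t • e) (c * t) ⊆ Ω)
      ⟨1, 1, by simp⟩ ?_ ?_ ?_
    · rintro s t hst ⟨c, T, hc, hc1, hT, H⟩
      exact ⟨c, T, hc, hc1, hT, fun x hx => H x ⟨hst hx.1, hx.2⟩⟩
    · rintro s t ⟨c, T, hc, hc1, hT, H⟩ ⟨c', T', hc', hc1', hT', H'⟩
      refine ⟨min c c', min T T', lt_min hc hc', (min_le_left _ _).trans hc1, lt_min hT hT',
        fun x hx => ?_⟩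
      rcases hx.1 with h | h
      · obtain ⟨e, he, hb⟩ := H x ⟨h, hx.2⟩
        exact ⟨e, he, fun τ hτ hτT => (Metric.ball_subset_ball
          (mul_le_mul_of_nonneg_right (min_le_left _ _) hτ.le)).trans
            (hb τ hτ (hτT.trans (min_le_left _ _)))⟩
      · obtain ⟨e, he, hb⟩ := H' x ⟨h, hx.2⟩
        exact ⟨e, he, fun τ hτ hτT => (Metric.ball_subset_ball
          (mul_le_mul_of_nonneg_right (min_le_right _ _) hτ.le)).trans
            (hb τ hτ (hτT.trans (min_le_right _ _)))⟩
    · intro x hx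
      obtain ⟨r, hr, h⟩ := exists_cone_local hΩ hx
      exact ⟨Metric.ball x r, mem_nhdsWithin_of_mem_nhds (Metric.ball_mem_nhds x hr), h⟩
  obtain ⟨c, T, hc, hc1, hT, H⟩ := key
  exact ⟨c, T, hc, hc1, hT, fun x hx => H x ⟨subset_closure hx, hx⟩⟩

/-! ### Elementary properties of meshes -/

section Mesh

variable {κ h : ℝ} {𝒦 : Finset (Set (Vec (m + 1)))}

lemma IsMesh.convex (H : IsMesh κ h 𝒦) {K : Set (Vec (m + 1))} (hK : K ∈ 𝒦) : Convex ℝ K := by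
  obtain ⟨s, rfl⟩ := H.polytope K hK
  exact convex_convexHull ℝ _

lemma IsMesh.isCompact (H : IsMesh κ h 𝒦) {K : Set (Vec (m + 1))} (hK : K ∈ 𝒦) :
    IsCompact K := by
  obtain ⟨s, rfl⟩ := H.polytope K hK
  exact s.finite_toSet.isCompact_convexHull ℝ

lemma IsMesh.interior_nonempty (H : IsMesh κ h 𝒦) (hκ : 0 < κ) (hh : 0 < h)
    {K : Set (Vec (m + 1))} (hK : K ∈ 𝒦) : (interior K).Nonempty := by
  obtain ⟨c, hc⟩ := H.inner_ball K hK
  exact ⟨c, interior_mono hc (Metric.ball_subset_interior_closedBall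
    (Metric.mem_ball_self (div_pos hh hκ)))⟩

lemma IsMesh.closure_interior (H : IsMesh κ h 𝒦) (hκ : 0 < κ) (hh : 0 < h)
    {K : Set (Vec (m + 1))} (hK : K ∈ 𝒦) : closure (interior K) = K := by
  rw [(H.convex hK).closure_interior_eq_closure_of_nonempty_interior
    (H.interior_nonempty hκ hh hK), (H.isCompact hK).isClosed.closure_eq]

lemma IsMesh.dist_le (H : IsMesh κ h 𝒦) {K : Set (Vec (m + 1))} (hK : K ∈ 𝒦) {x y : Vec (m + 1)}
    (hx : x ∈ K) (hy : y ∈ K) : dist x y ≤ κ * h :=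
  (Metric.dist_le_diam_of_mem (H.isCompact hK).isBounded hx hy).trans (H.diam_le K hK)

/-- Each element is the closure of its interior, so a neighbourhood of `x` inside `K` also meets the
interior of `K'`. -/
lemma IsMesh.eq_of_mem_interior (H : IsMesh κ h 𝒦) (hκ : 0 < κ) (hh : 0 < h)
    {K K' : Set (Vec (m + 1))} (hK : K ∈ 𝒦) (hK' : K' ∈ 𝒦) {x : Vec (m + 1)}
    (hx : x ∈ interior K) (hx' : x ∈ K') : K = K' := by
  by_contra hne
  rw [← H.closure_interior hκ hh hK'] at hx'
  obtain ⟨y, hy, hy'⟩ := mem_closure_iff.1 hx' _ isOpen_interior hx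
  exact disjoint_left.1 (H.disjoint K hK K' hK' hne) hy hy'

/-- Dimension `m + 1` is excluded because the interiors are disjoint, and dimension `m` because no
face is shared. Adding one point raises the dimension by at most one, so the span remains Lebesgue
null. -/
lemma IsMesh.affineSpan_insert_ne_top (H : IsMesh κ h 𝒦) {K K' : Set (Vec (m + 1))} (hK : K ∈ 𝒦)
    (hK' : K' ∈ 𝒦) (hne : K ≠ K') (hn : (K ∩ K').Nonempty) (hs : ¬ ShareFace K K')
    (x : Vec (m + 1)) : affineSpan ℝ (insert x (K ∩ K')) ≠ ⊤ := by
  have hle : Module.finrank ℝ (vectorSpan ℝ (K ∩ K')) ≤ m + 1 := by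
    simpa using Submodule.finrank_le (vectorSpan ℝ (K ∩ K'))
  have h1 : Module.finrank ℝ (vectorSpan ℝ (K ∩ K')) ≠ m + 1 := by
    intro heq
    have htop : vectorSpan ℝ (K ∩ K') = ⊤ :=
      Submodule.eq_top_of_finrank_eq (by simpa using heq)
    rw [← AffineSubspace.affineSpan_eq_top_iff_vectorSpan_eq_top_of_nonempty _ _ _ hn,
      ← ((H.convex hK).inter (H.convex hK')).interior_nonempty_iff_affineSpan_eq_top,
      interior_inter] at htop
    obtain ⟨y, hy, hy'⟩ := htop
    exact disjoint_left.1 (H.disjoint K hK K' hK' hne) hy hy'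
  have h2 : Module.finrank ℝ (vectorSpan ℝ (K ∩ K')) ≠ m := fun h => hs (by
    unfold ShareFace; omega)
  intro htop
  have h3 := finrank_vectorSpan_insert_le_set ℝ (K ∩ K') x
  rw [← direction_affineSpan, htop, AffineSubspace.direction_top, finrank_top,
    finrank_euclideanSpace, Fintype.card_fin] at h3
  omega

lemma mem_activeMesh {Ω : Set (Vec (m + 1))} {K : Set (Vec (m + 1))} :
    K ∈ activeMesh Ω 𝒦 ↔ K ∈ 𝒦 ∧ (K ∩ Ω).Nonempty := by
  classical
  simp [activeMesh]

lemma mem_stabFaces {Ω : Set (Vec (m + 1))} {P : Set (Vec (m + 1)) × Set (Vec (m + 1))} :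
    P ∈ stabFaces Ω 𝒦 ↔ (P.1 ∈ activeMesh Ω 𝒦 ∧ P.2 ∈ activeMesh Ω 𝒦) ∧ P.1 ≠ P.2 ∧
      ShareFace P.1 P.2 ∧ ((P.1 ∩ frontier Ω).Nonempty ∨ (P.2 ∩ frontier Ω).Nonempty) := by
  classical
  simp [stabFaces]

/-! ### Generic segments and chains of elements -/

/-- Every ball contains a point `y` such that the segment from `x` to `y` only crosses from one
element to another through common faces. -/
lemma IsMesh.exists_generic_segment (H : IsMesh κ h 𝒦) (hκ : 0 < κ) (hh : 0 < h)
    {K : Set (Vec (m + 1))} (hK : K ∈ 𝒦) {x : Vec (m + 1)} (hx : x ∈ interior K)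
    (y₀ : Vec (m + 1)) {r : ℝ} (hr : 0 < r) :
    ∃ y ∈ Metric.ball y₀ r, ∀ K₁ ∈ 𝒦, ∀ K₂ ∈ 𝒦, K₁ ≠ K₂ →
      (K₁ ∩ K₂ ∩ segment ℝ x y).Nonempty → ShareFace K₁ K₂ := by
  classical
  let bad := (𝒦 ×ˢ 𝒦).filter fun P => P.1 ≠ P.2 ∧ (P.1 ∩ P.2).Nonempty ∧ ¬ ShareFace P.1 P.2
  let Z : Set (Vec (m + 1)) := ⋃ P ∈ bad, (affineSpan ℝ (insert x (P.1 ∩ P.2)) : Set (Vec (m + 1)))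
  have hZ : volume Z = 0 := by
    refine (measure_biUnion_null_iff bad.countable_toSet).2 fun P hP => ?_
    obtain ⟨hP1, hP2, hP3, hP4⟩ := Finset.mem_filter.1 hP
    obtain ⟨hP5, hP6⟩ := Finset.mem_product.1 hP1
    exact Measure.addHaar_affineSubspace _ _
      (H.affineSpan_insert_ne_top hP5 hP6 hP2 hP3 hP4 x)
  have hpos : 0 < volume (Metric.ball y₀ r \ Z) := by
    rw [measure_sdiff_null hZ]
    exact Metric.measure_ball_pos _ _ hr
  obtain ⟨y, hy, hyZ⟩ := nonempty_of_measure_ne_zero hpos.ne'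
  refine ⟨y, hy, fun K₁ h₁ K₂ h₂ hne ⟨z, ⟨hz₁, hz₂⟩, hz⟩ => ?_⟩
  by_contra hsf
  refine hyZ (mem_iUnion₂.2 ⟨(K₁, K₂), Finset.mem_filter.2 ⟨Finset.mem_product.2 ⟨h₁, h₂⟩, hne,
    ⟨z, hz₁, hz₂⟩, hsf⟩, ?_⟩)
  -- The point `x` belongs to one element only, so `z ≠ x` and the line through `x` and `z` carries
  -- `y` into the null set `Z`.
  have hzx : z ≠ x := by
    rintro rfl
    exact hne ((H.eq_of_mem_interior hκ hh hK h₁ hx hz₁).symm.trans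
      (H.eq_of_mem_interior hκ hh hK h₂ hx hz₂))
  rw [segment_eq_image_lineMap] at hz
  obtain ⟨t, -, rfl⟩ := hz
  have ht : t ≠ 0 := by rintro rfl; simp at hzx
  have e : y = AffineMap.lineMap x (AffineMap.lineMap x y t) t⁻¹ := by
    rw [AffineMap.lineMap_lineMap_right, inv_mul_cancel₀ ht, AffineMap.lineMap_apply_one]
  rw [e]
  exact AffineMap.lineMap_mem _ (mem_affineSpan ℝ (mem_insert _ _))
    (mem_affineSpan ℝ (mem_insert_of_mem _ ⟨hz₁, hz₂⟩))

/-- If the points of `ball y r` lie in `Ω`, an element containing `y` contains a ball of radius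
proportional to `h` inside `Ω`. -/
lemma IsMesh.exists_closedBall_subset (H : IsMesh κ h 𝒦) (hκ : 0 < κ) (hh : 0 < h)
    {K : Set (Vec (m + 1))} (hK : K ∈ 𝒦) {y : Vec (m + 1)} (hy : y ∈ K) {s r : ℝ} (hs : 0 ≤ s)
    (hs1 : s ≤ 1) (hsr : s * (κ + κ⁻¹) * h < r) :
    ∃ z, Metric.closedBall z (s / κ * h) ⊆ K ∩ Metric.ball y r := by
  obtain ⟨c, hc⟩ := H.inner_ball K hK
  have hcK : c ∈ K := hc (Metric.mem_closedBall_self (by positivity))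
  -- The ball is the image of the inner ball of `K` under the homothety with centre `y` and ratio
  -- `s`.
  refine ⟨y + s • (c - y), fun w hw => ⟨?_, ?_⟩⟩
  · rcases hs.eq_or_lt with rfl | hs0
    · have : w = y := by simpa using hw
      rwa [this]
    set c' := c + s⁻¹ • (w - (y + s • (c - y))) with hc'
    have hc'K : c' ∈ K := by
      apply hc
      rw [hc', Metric.mem_closedBall, dist_eq_norm, add_sub_cancel_left, norm_smul,
        Real.norm_of_nonneg (by positivity), ← dist_eq_norm]
      rw [Metric.mem_closedBall] at hw
      rw [inv_mul_le_iff₀ hs0]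
      exact hw.trans (le_of_eq (by ring))
    have e : w = (1 - s) • y + s • c' := by
      rw [hc', smul_add, smul_smul, mul_inv_cancel₀ hs0.ne']
      module
    rw [e]
    exact H.convex hK hy hc'K (by linarith) hs (by ring)
  · rw [Metric.mem_closedBall] at hw
    rw [Metric.mem_ball]
    refine lt_of_le_of_lt ?_ hsr
    have h1 : dist (y + s • (c - y)) y ≤ s * (κ * h) := by
      rw [dist_eq_norm, add_sub_cancel_left, norm_smul, Real.norm_of_nonneg hs, ← dist_eq_norm]
      exact mul_le_mul_of_nonneg_left (H.dist_le hK hcK hy) hs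
    calc dist w y ≤ _ := dist_triangle _ _ _
      _ ≤ s / κ * h + s * (κ * h) := add_le_add hw h1
      _ = _ := by rw [div_eq_mul_inv]; ring

/-- Elements are connected through stabilized faces, within a distance proportional to `h`, to an
element whose intersection with `Ω` contains a ball with radius proportional to `h`. -/
lemma IsLipschitzDomain.exists_chain {Ω : Set (Vec (m + 1))} (hΩ : IsLipschitzDomain Ω) {κ h₀ : ℝ}
    (hκ : 0 < κ) (hh₀ : 0 < h₀) : ∃ r R : ℝ, 0 < r ∧ 1 ≤ R ∧ ∀ h : ℝ, 0 < h → h ≤ h₀ →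
      ∀ 𝒦 : Finset (Set (Vec (m + 1))), IsMesh κ h 𝒦 → Ω ⊆ ⋃ K ∈ 𝒦, K →
      ∀ K ∈ activeMesh Ω 𝒦, ∃ x ∈ K, ∃ K' ∈ activeMesh Ω 𝒦,
        Relation.ReflTransGen (fun K₁ K₂ => (K₁, K₂) ∈ stabFaces Ω 𝒦 ∧
          K₁ ∩ K₂ ⊆ Metric.closedBall x (R * h)) K K' ∧
        ∃ z, Metric.closedBall z (r * h) ⊆ K' ∩ Ω ∧
          Metric.closedBall z (r * h) ⊆ Metric.closedBall x (R * h) := by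
  classical
  obtain ⟨c, T, hc, hc1, hT, hcone⟩ := hΩ.exists_cone
  -- With this choice the step `t = τ * h` never exceeds the cone length `T`.
  set τ := T / h₀ with hτ
  have hτ0 : 0 < τ := by positivity
  obtain ⟨s, hs0, hs1, hsτ⟩ : ∃ s : ℝ, 0 < s ∧ s ≤ 1 ∧ s * (κ + κ⁻¹) < c * τ / 2 := by
    refine ⟨min 1 (c * τ / (4 * (κ + κ⁻¹))), by positivity, min_le_left _ _, ?_⟩
    have h0 : 0 < κ + κ⁻¹ := by positivity
    have := mul_le_mul_of_nonneg_right (min_le_right 1 (c * τ / (4 * (κ + κ⁻¹)))) h0.le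
    refine this.trans_lt ?_
    rw [div_mul_eq_mul_div, div_lt_iff₀ (by positivity)]
    nlinarith [mul_pos (mul_pos hc hτ0) h0]
  -- The segment stays within `2 * τ * h` of `x`, and an element meeting it adds a diameter `κ * h`;
  -- the summand `1` ensures `1 ≤ R`.
  refine ⟨s / κ, 2 * τ + κ + 1, by positivity, by linarith, ?_⟩
  intro h hh hhh 𝒦 H hcov K hK
  obtain ⟨hK𝒦, w, hwK, hwΩ⟩ := mem_activeMesh.1 hK
  obtain ⟨x, hxΩ, hxK⟩ : (Ω ∩ interior K).Nonempty := by
    rw [← H.closure_interior hκ hh hK𝒦] at hwK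
    exact mem_closure_iff.1 hwK _ hΩ.isOpen hwΩ
  obtain ⟨e, he, hball⟩ := hcone x hxΩ
  set t := τ * h with ht
  have ht0 : 0 < t := by positivity
  have htT : t ≤ T := by
    rw [ht, hτ, div_mul_eq_mul_div, div_le_iff₀ hh₀]; gcongr
  obtain ⟨y, hy, hgen⟩ := H.exists_generic_segment hκ hh hK𝒦 hxK (x + t • e)
    (r := c * t / 2) (by positivity)
  have hyb : Metric.ball y (c * t / 2) ⊆ Ω := by
    refine subset_trans (fun z hz => ?_) (hball t ht0 htT)
    rw [Metric.mem_ball] at *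
    linarith [dist_triangle z y (x + t • e)]
  have hyx : dist y x ≤ 2 * t := by
    have h1 : dist (x + t • e) x = t := by
      rw [dist_eq_norm, add_sub_cancel_left, norm_smul, he, mul_one, Real.norm_of_nonneg ht0.le]
    rw [Metric.mem_ball] at hy
    nlinarith [dist_triangle y (x + t • e) x]
  -- The balls of the cone scale linearly with the distance from `x`, so the point at parameter `θ`
  -- lies in the ball at height `θ * t`.
  have hsegΩ : segment ℝ x y ⊆ Ω := by
    intro z hz
    rw [segment_eq_image'] at hz
    obtain ⟨θ, hθ, rfl⟩ := hz
    rcases hθ.1.eq_or_lt with rfl | hθ0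
    · simpa using hxΩ
    · refine hball (θ * t) (by positivity) (by nlinarith [hθ.2]) ?_
      have : x + θ • (y - x) - (x + (θ * t) • e) = θ • (y - (x + t • e)) := by module
      rw [Metric.mem_ball, dist_eq_norm, this, norm_smul, Real.norm_of_nonneg hθ.1,
        ← dist_eq_norm]
      rw [Metric.mem_ball] at hy
      nlinarith [mul_lt_mul_of_pos_left hy hθ0, mul_pos hθ0 (mul_pos hc ht0)]
  have hseg : ∀ z ∈ segment ℝ x y, dist z x ≤ 2 * t := fun z hz => by
    have := (convex_closedBall x (2 * t)).segment_subset
      (Metric.mem_closedBall_self (by positivity)) (Metric.mem_closedBall.2 hyx) hz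
    exact this
  have hnear : ∀ K₁ ∈ 𝒦, (K₁ ∩ segment ℝ x y).Nonempty →
      K₁ ⊆ Metric.closedBall x ((2 * τ + κ + 1) * h) := by
    rintro K₁ h₁ ⟨z, hz, hzs⟩ w hw
    rw [Metric.mem_closedBall]
    have := H.dist_le h₁ hw hz
    have := hseg z hzs
    nlinarith [dist_triangle w z x]
  set Step : Set (Vec (m + 1)) → Set (Vec (m + 1)) → Prop := fun K₁ K₂ =>
    (K₁, K₂) ∈ stabFaces Ω 𝒦 ∧ K₁ ∩ K₂ ⊆ Metric.closedBall x ((2 * τ + κ + 1) * h) with hStep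
  refine ⟨x, interior_subset hxK, ?_⟩
  -- If the walk reaches an element inside `Ω`, it stops there and uses its inner ball. Otherwise
  -- every element reached along the segment meets the boundary, so all faces crossed are stabilized
  -- up to the element containing `y`.
  by_cases hin : ∃ K' ∈ 𝒦, Relation.ReflTransGen Step K K' ∧ (K' ∩ segment ℝ x y).Nonempty ∧ K' ⊆ Ω
  · obtain ⟨K', hK', hreach, hmeet, hsub⟩ := hin
    obtain ⟨z, hz⟩ := H.inner_ball K' hK'
    have hz' : Metric.closedBall z (s / κ * h) ⊆ K' := by
      refine (Metric.closedBall_subset_closedBall ?_).trans hz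
      rw [div_mul_eq_mul_div]
      gcongr
      nlinarith
    have hact : K' ∈ activeMesh Ω 𝒦 := by
      obtain ⟨w, hw, -⟩ := hmeet
      exact mem_activeMesh.2 ⟨hK', w, hw, hsub hw⟩
    exact ⟨K', hact, hreach, z, subset_inter hz' (hz'.trans hsub),
      hz'.trans (hnear K' hK' hmeet)⟩
  · push Not at hin
    have hfr : ∀ K' ∈ 𝒦, Relation.ReflTransGen Step K K' → (K' ∩ segment ℝ x y).Nonempty →
        (K' ∩ frontier Ω).Nonempty := by
      intro K' hK' hreach hmeet
      by_contra hne
      apply hin K' hK' hreach hmeet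
      -- A connected element that meets `Ω` but not its boundary lies in `Ω`.
      refine (H.convex hK').isPreconnected.subset_left_of_subset_union hΩ.isOpen
        (isClosed_closure (s := Ω)).isOpen_compl ?_ ?_ ?_
      · exact disjoint_compl_right_iff_subset.2 subset_closure
      · intro w hw
        by_contra hw'
        rw [mem_union, not_or, notMem_compl_iff] at hw'
        exact hne ⟨w, hw, hw'.2, fun h => hw'.1 (interior_subset h)⟩
      · obtain ⟨w, hw, hws⟩ := hmeet
        exact ⟨w, hw, hsegΩ hws⟩
    obtain ⟨K', hK', hyK'⟩ := mem_iUnion₂.1 (hcov (hsegΩ (right_mem_segment ℝ x y)))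
    -- Reached and unreached elements form two closed sets covering the connected segment. A common
    -- point on the segment would be a crossing through a stabilized face, making the unreached
    -- element reached.
    have hreach : Relation.ReflTransGen Step K K' := by
      by_contra hnr
      let U := ⋃ K₁ ∈ 𝒦.filter fun K₁ => Relation.ReflTransGen Step K K₁, K₁
      let V := ⋃ K₁ ∈ 𝒦.filter fun K₁ => ¬ Relation.ReflTransGen Step K K₁, K₁
      have hcl : ∀ s : Finset (Set (Vec (m + 1))), s ⊆ 𝒦 → IsClosed (⋃ K₁ ∈ s, K₁) :=
        fun s hs => s.finite_toSet.isClosed_biUnion fun K₁ h₁ => (H.isCompact (hs h₁)).isClosed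
      have hsegUV : segment ℝ x y ⊆ U ∪ V := by
        intro z hz
        obtain ⟨K₁, h₁, hz₁⟩ := mem_iUnion₂.1 (hcov (hsegΩ hz))
        by_cases hr : Relation.ReflTransGen Step K K₁
        · exact Or.inl (mem_iUnion₂.2 ⟨K₁, Finset.mem_filter.2 ⟨h₁, hr⟩, hz₁⟩)
        · exact Or.inr (mem_iUnion₂.2 ⟨K₁, Finset.mem_filter.2 ⟨h₁, hr⟩, hz₁⟩)
      obtain ⟨z, hzs, hzU, hzV⟩ := isPreconnected_closed_iff.1
        (convex_segment x y).isPreconnected U V (hcl _ (Finset.filter_subset _ _))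
        (hcl _ (Finset.filter_subset _ _)) hsegUV
        ⟨x, left_mem_segment ℝ x y, mem_iUnion₂.2 ⟨K, Finset.mem_filter.2 ⟨hK𝒦, .refl⟩,
          interior_subset hxK⟩⟩
        ⟨y, right_mem_segment ℝ x y, mem_iUnion₂.2 ⟨K', Finset.mem_filter.2 ⟨hK', hnr⟩, hyK'⟩⟩
      obtain ⟨K₁, h₁, hz₁⟩ := mem_iUnion₂.1 hzU
      obtain ⟨K₂, h₂, hz₂⟩ := mem_iUnion₂.1 hzV
      obtain ⟨h₁, hr₁⟩ := Finset.mem_filter.1 h₁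
      obtain ⟨h₂, hr₂⟩ := Finset.mem_filter.1 h₂
      have hne : K₁ ≠ K₂ := by rintro rfl; exact hr₂ hr₁
      refine hr₂ (hr₁.tail ⟨mem_stabFaces.2 ⟨⟨mem_activeMesh.2 ⟨h₁, z, hz₁, hsegΩ hzs⟩,
        mem_activeMesh.2 ⟨h₂, z, hz₂, hsegΩ hzs⟩⟩, hne,
        hgen K₁ h₁ K₂ h₂ hne ⟨z, ⟨hz₁, hz₂⟩, hzs⟩, Or.inl (hfr K₁ h₁ hr₁ ⟨z, hz₁, hzs⟩)⟩, ?_⟩)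
      exact inter_subset_left.trans (hnear K₁ h₁ ⟨z, hz₁, hzs⟩)
    have hmeet : (K' ∩ segment ℝ x y).Nonempty := ⟨y, hyK', right_mem_segment ℝ x y⟩
    obtain ⟨z, hz⟩ := H.exists_closedBall_subset hκ hh hK' hyK' (s := s) (r := c * t / 2) hs0.le
      hs1 (by rw [ht]; nlinarith)
    have hzK : Metric.closedBall z (s / κ * h) ⊆ K' := hz.trans inter_subset_left
    refine ⟨K', mem_activeMesh.2 ⟨hK', y, hyK', hsegΩ (right_mem_segment ℝ x y)⟩, hreach, z,
      subset_inter hzK ((hz.trans inter_subset_right).trans hyb),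
      hzK.trans (hnear K' hK' hmeet)⟩

end Mesh

end Geometry

/-! ### Chains in finite sets -/

/-- The chain is cut at its last visit to `a`. -/
lemma reflTransGen_avoid {α : Type*} {r : α → α → Prop} {a b : α} (h : Relation.ReflTransGen r a b) :
    a = b ∨ ∃ a', r a a' ∧ a' ≠ a ∧
      Relation.ReflTransGen (fun x y => r x y ∧ x ≠ a ∧ y ≠ a) a' b := by
  induction h with
  | refl => exact Or.inl rfl
  | @tail b c hab hbc ih =>
    by_cases hc : c = a
    · exact Or.inl hc.symm
    by_cases hb : b = a
    · subst hb
      exact Or.inr ⟨c, hbc, hc, .refl⟩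
    rcases ih with ih | ⟨a', h1, h2, h3⟩
    · exact absurd ih.symm hb
    · exact Or.inr ⟨a', h1, h2, h3.tail ⟨hbc, hb, hc⟩⟩

/-- Along a chain in a finite set, a function with bounded increments has bounded variation. -/
lemma abs_sub_le_of_reflTransGen {α : Type*} {g : α → ℝ} {D : ℝ} (hD : 0 ≤ D) (S : Finset α)
    {r : α → α → Prop} (hr : ∀ x y, r x y → x ∈ S ∧ |g x - g y| ≤ D) {a b : α}
    (h : Relation.ReflTransGen r a b) : |g a - g b| ≤ S.card * D := by
  classical
  induction hn : S.card generalizing S r a with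
  | zero =>
    rcases reflTransGen_avoid h with rfl | ⟨a', h1, -⟩
    · simp
    · have := (hr _ _ h1).1
      rw [Finset.card_eq_zero] at hn
      simp [hn] at this
  | succ n ih =>
    -- Since the rest of the chain avoids `a`, it lives in `S.erase a`; every element of `S` is thus
    -- charged at most once.
    rcases reflTransGen_avoid h with rfl | ⟨a', h1, -, h3⟩
    · simp only [sub_self, abs_zero]; positivity
    · obtain ⟨haS, hle⟩ := hr _ _ h1
      have := ih (S.erase a) (fun x y hxy => ⟨Finset.mem_erase.2 ⟨hxy.2.1, (hr _ _ hxy.1).1⟩,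
        (hr _ _ hxy.1).2⟩) h3 (by rw [Finset.card_erase_of_mem haS, hn]; rfl)
      push_cast
      linarith [abs_sub_le (g a) (g a') (g b)]

/-! ### Volume packing and observables across a single face -/

section Bound

variable {m : ℕ}

lemma volume_ball_real {n : ℕ} (x : Vec n) {r : ℝ} (hr : 0 ≤ r) :
    volume.real (Metric.closedBall x r) = r ^ n * volume.real (Metric.ball (0 : Vec n) 1) := by
  rw [Measure.real, Measure.addHaar_closedBall volume x hr, ENNReal.toReal_mul,
    ENNReal.toReal_ofReal (by positivity)]
  simp [Measure.real]

/-- The interiors are disjoint, each contains a ball of radius `h / κ`, and all lie in a ball of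
radius `ρ * h`. This bounds both the chain length and the overlap of neighbourhoods. -/
lemma IsMesh.card_le {κ h ρ : ℝ} {𝒦 : Finset (Set (Vec (m + 1)))} (H : IsMesh κ h 𝒦) (hκ : 0 < κ)
    (hh : 0 < h) (hρ : 0 ≤ ρ) (S : Finset (Set (Vec (m + 1)))) (hS : S ⊆ 𝒦) (x : Vec (m + 1))
    (hx : ∀ K ∈ S, K ⊆ Metric.closedBall x (ρ * h)) : (S.card : ℝ) ≤ (ρ * κ) ^ (m + 1) := by
  set V := volume.real (Metric.ball (0 : Vec (m + 1)) 1) with hV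
  have hVpos : 0 < V := ENNReal.toReal_pos (Metric.measure_ball_pos _ _ one_pos).ne'
    measure_ball_lt_top.ne
  have hlow : ∀ K ∈ S, (h / κ) ^ (m + 1) * V ≤ volume.real (interior K) := by
    intro K hK
    obtain ⟨c, hc⟩ := H.inner_ball K (hS hK)
    have h1 : volume.real (Metric.ball c (h / κ)) ≤ volume.real (interior K) :=
      measureReal_mono (interior_maximal (Metric.ball_subset_closedBall.trans hc)
        Metric.isOpen_ball)
        ((H.isCompact (hS hK)).isBounded.subset interior_subset).measure_lt_top.ne
    rwa [Measure.real, Measure.addHaar_ball_of_pos volume c (by positivity), ENNReal.toReal_mul,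
      ENNReal.toReal_ofReal (by positivity), finrank_euclideanSpace, Fintype.card_fin] at h1
  have hsum : ∑ K ∈ S, volume.real (interior K) ≤
      volume.real (Metric.closedBall x (ρ * h)) := by
    rw [← measureReal_biUnion_finset
      (fun K hK K' hK' hne => H.disjoint K (hS hK) K' (hS hK') hne)
      (fun K _ => isOpen_interior.measurableSet) (fun K hK =>
        ((H.isCompact (hS hK)).isBounded.subset interior_subset).measure_lt_top.ne)]
    exact measureReal_mono (iUnion₂_subset fun K hK => interior_subset.trans (hx K hK))
      Metric.isBounded_closedBall.measure_lt_top.ne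
  have h2 := (Finset.sum_le_sum hlow).trans hsum
  rw [Finset.sum_const, nsmul_eq_mul, volume_ball_real x (by positivity), ← hV, div_pow,
    mul_pow] at h2
  have hhp : 0 < h ^ (m + 1) := by positivity
  have hκp : 0 < κ ^ (m + 1) := by positivity
  have h3 : (S.card : ℝ) * (h ^ (m + 1) * V) ≤ (ρ * κ) ^ (m + 1) * (h ^ (m + 1) * V) := by
    calc (S.card : ℝ) * (h ^ (m + 1) * V) =
          κ ^ (m + 1) * (S.card * (h ^ (m + 1) / κ ^ (m + 1) * V)) := by field_simp
      _ ≤ κ ^ (m + 1) * (ρ ^ (m + 1) * h ^ (m + 1) * V) := by gcongr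
      _ = _ := by ring
  exact le_of_mul_le_mul_right h3 (by positivity)

/-! ### Quantities derived from a polynomial vector field -/

/-- `T` maps polynomial vector fields to polynomials, preserves the degree bound `p`, and scales
like a derivative of order `s`. -/
def IsObservable (p s : ℕ) {n : ℕ}
    (T : (Fin n → MvPolynomial (Fin n) ℝ) →ₗ[ℝ] MvPolynomial (Fin n) ℝ) : Prop :=
  (∀ q, (∀ i, (q i).totalDegree ≤ p) → (T q).totalDegree ≤ p) ∧
  ∀ ρ : ℝ, ∃ C : ℝ, 0 < C ∧ ∀ q, (∀ i, (q i).totalDegree ≤ p) → ∀ (x₀ : Vec n) (r : ℝ), 0 < r →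
    ∀ x, dist x x₀ ≤ ρ * r → pev (T q) x ^ 2 * r ^ n ≤
      C * (r ^ (2 * s))⁻¹ * ∑ i, ∫ y in Metric.closedBall x₀ r, pev (q i) y ^ 2

lemma isObservable_proj (p : ℕ) {n : ℕ} (i : Fin n) :
    IsObservable p 0 (LinearMap.proj (R := ℝ) (φ := fun _ : Fin n => MvPolynomial (Fin n) ℝ) i) := by
  refine ⟨fun q hq => hq i, fun ρ => ?_⟩
  obtain ⟨C, hC, H⟩ := exists_pev_sq_le n p ρ
  refine ⟨C, hC, fun q hq x₀ r hr x hx => ((H _ (hq i) x₀ r hr x hx).1).trans ?_⟩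
  simp only [mul_zero, pow_zero, inv_one, mul_one]
  gcongr
  exact Finset.single_le_sum (f := fun i => ∫ y in Metric.closedBall x₀ r, pev (q i) y ^ 2)
    (fun i _ => integral_nonneg fun _ => sq_nonneg _) (Finset.mem_univ i)

lemma isObservable_pderiv (p : ℕ) {n : ℕ} (i j : Fin n) :
    IsObservable p 1 ((MvPolynomial.pderiv j : Derivation ℝ (MvPolynomial (Fin n) ℝ) _).toLinearMap ∘ₗ
      LinearMap.proj (R := ℝ) (φ := fun _ : Fin n => MvPolynomial (Fin n) ℝ) i) := by
  refine ⟨fun q hq => (totalDegree_pderiv_le j (q i)).trans ((Nat.sub_le _ _).trans (hq i)),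
    fun ρ => ?_⟩
  obtain ⟨C, hC, H⟩ := exists_pev_sq_le n p ρ
  refine ⟨C, hC, fun q hq x₀ r hr x hx => ((H _ (hq i) x₀ r hr x hx).2 j).trans ?_⟩
  rw [mul_one]
  gcongr
  exact Finset.single_le_sum (f := fun i => ∫ y in Metric.closedBall x₀ r, pev (q i) y ^ 2)
    (fun i _ => integral_nonneg fun _ => sq_nonneg _) (Finset.mem_univ i)

lemma IsObservable.add {p s n : ℕ}
    {T T' : (Fin n → MvPolynomial (Fin n) ℝ) →ₗ[ℝ] MvPolynomial (Fin n) ℝ}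
    (h : IsObservable p s T) (h' : IsObservable p s T') : IsObservable p s (T + T') := by
  refine ⟨fun q hq => (MvPolynomial.totalDegree_add _ _).trans (max_le (h.1 q hq) (h'.1 q hq)),
    fun ρ => ?_⟩
  obtain ⟨C, hC, H⟩ := h.2 ρ
  obtain ⟨C', hC', H'⟩ := h'.2 ρ
  refine ⟨2 * (C + C'), by positivity, fun q hq x₀ r hr x hx => ?_⟩
  have h1 := H q hq x₀ r hr x hx
  have h2 := H' q hq x₀ r hr x hx
  rw [LinearMap.add_apply, pev_add]
  have h3 : (pev (T q) x + pev (T' q) x) ^ 2 ≤ 2 * (pev (T q) x ^ 2 + pev (T' q) x ^ 2) := by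
    nlinarith [sq_nonneg (pev (T q) x - pev (T' q) x)]
  have h4 := mul_le_mul_of_nonneg_right h3 (pow_nonneg hr.le n)
  linarith

lemma IsObservable.smul {p s n : ℕ}
    {T : (Fin n → MvPolynomial (Fin n) ℝ) →ₗ[ℝ] MvPolynomial (Fin n) ℝ}
    (h : IsObservable p s T) (a : ℝ) : IsObservable p s (a • T) := by
  refine ⟨fun q hq => (MvPolynomial.totalDegree_smul_le _ _).trans (h.1 q hq), fun ρ => ?_⟩
  obtain ⟨C, hC, H⟩ := h.2 ρ
  refine ⟨(a ^ 2 + 1) * C, by positivity, fun q hq x₀ r hr x hx => ?_⟩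
  have h1 := H q hq x₀ r hr x hx
  rw [LinearMap.smul_apply, pev_smul]
  have h2 := mul_le_mul_of_nonneg_left h1 (by positivity : 0 ≤ a ^ 2 + 1)
  have h3 : 0 ≤ pev (T q) x ^ 2 * r ^ n := by positivity
  linarith

/-- The contribution of one face to `j_h(v, v)`. -/
def faceTerm (p : ℕ) (h : ℝ) (v : Vec (m + 1) → Vec (m + 1))
    (P : Set (Vec (m + 1)) × Set (Vec (m + 1))) : ℝ :=
  ∑ l ∈ Finset.Icc 1 p, h ^ (2 * l + 1) *
    ∫ x in P.1 ∩ P.2, inner ℝ (jump l P.1 P.2 v x) (jump l P.1 P.2 v x) ∂μHE[m]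

lemma faceTerm_nonneg (p : ℕ) {h : ℝ} (hh : 0 ≤ h) (v : Vec (m + 1) → Vec (m + 1))
    (P : Set (Vec (m + 1)) × Set (Vec (m + 1))) : 0 ≤ faceTerm p h v P :=
  Finset.sum_nonneg fun _ _ => mul_nonneg (by positivity)
    (integral_nonneg fun _ => real_inner_self_nonneg)

lemma jForm_eq (p : ℕ) (h : ℝ) (Ω : Set (Vec (m + 1))) (𝒦 : Finset (Set (Vec (m + 1))))
    (v : Vec (m + 1) → Vec (m + 1)) :
    jForm p h Ω 𝒦 v v = 1 / 2 * ∑ P ∈ stabFaces Ω 𝒦, faceTerm p h v P := rfl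

/-- The values of an observable on both sides of a face differ by a multiple of the jumps. -/
lemma IsObservable.exists_face_bound {p s : ℕ}
    {T : (Fin (m + 1) → MvPolynomial (Fin (m + 1)) ℝ) →ₗ[ℝ] MvPolynomial (Fin (m + 1)) ℝ}
    (hT : IsObservable p s T) {κ ρ : ℝ} (hκ : 0 < κ) (hρ : 1 ≤ ρ) :
    ∃ C : ℝ, 0 < C ∧ ∀ h : ℝ, 0 < h → ∀ 𝒦 : Finset (Set (Vec (m + 1))), IsMesh κ h 𝒦 →
      ∀ K₁ ∈ 𝒦, ∀ K₂ ∈ 𝒦, K₁ ≠ K₂ → ShareFace K₁ K₂ →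
      ∀ (v : Vec (m + 1) → Vec (m + 1)) (q₁ q₂ : Fin (m + 1) → MvPolynomial (Fin (m + 1)) ℝ),
      (∀ i, (q₁ i).totalDegree ≤ p) → (∀ i, (q₂ i).totalDegree ≤ p) →
      EqOn v (pmap q₁) K₁ → EqOn v (pmap q₂) K₂ → ∀ x : Vec (m + 1),
      (∀ c ∈ K₁ ∩ K₂, dist x c ≤ ρ * h) →
      (pev (T q₁) x - pev (T q₂) x) ^ 2 * h ^ (m + 1) ≤
        C * (h ^ (2 * s))⁻¹ * faceTerm p h v (K₁, K₂) := by
  obtain ⟨C₁, hC₁, H₁⟩ := CutFEM.exists_face_bound m p hκ hρ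
  obtain ⟨C₂, hC₂, H₂⟩ := hT.2 ρ
  set V := volume.real (Metric.ball (0 : Vec (m + 1)) 1) with hV
  -- The factor `m + 1` counts components; `V + 1` makes positivity immediate.
  refine ⟨C₂ * ((m + 1) * (C₁ * (V + 1))), by positivity, ?_⟩
  intro h hh 𝒦 H K₁ h₁ K₂ h₂ hne hsh v q₁ q₂ hq₁ hq₂ hv₁ hv₂ x hx
  obtain ⟨c, hc, hdisc⟩ := H.inner_disc K₁ h₁ K₂ h₂ hne hsh
  have hb := H₁ h hh K₁ K₂ (H.convex h₁) (H.convex h₂) (H.isCompact h₁) (H.isCompact h₂)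
    (H.interior_nonempty hκ hh h₁) (H.interior_nonempty hκ hh h₂) hsh c hc hdisc v q₁ q₂ hq₁ hq₂
    hv₁ hv₂
  set J := faceTerm p h v (K₁, K₂) with hJ
  have hJ0 : 0 ≤ J := faceTerm_nonneg p hh.le v _
  have hhp : 0 < h ^ (m + 1) := by positivity
  -- The face estimate holds throughout a ball of radius `h` about `c`, off the face as well, so it
  -- gives the `L²` bound that `T` requires.
  have hint : ∀ i, ∫ y in Metric.closedBall c h, pev ((q₁ - q₂) i) y ^ 2 ≤ C₁ * (V + 1) * J := by
    intro i
    have hbd : ∀ y ∈ Metric.closedBall c h,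
        pev ((q₁ - q₂) i) y ^ 2 ≤ C₁ * J / h ^ (m + 1) := by
      intro y hy
      rw [le_div_iff₀ hhp]
      exact hb i y ((Metric.mem_closedBall.1 hy).trans (le_mul_of_one_le_left hh.le hρ))
    calc _ ≤ ∫ y in Metric.closedBall c h, C₁ * J / h ^ (m + 1) :=
          setIntegral_mono_on (pev_integrableOn _ Metric.isBounded_closedBall)
            (integrableOn_const Metric.isBounded_closedBall.measure_lt_top.ne)
            Metric.isClosed_closedBall.measurableSet hbd
      _ = C₁ * V * J := by
          rw [setIntegral_const, volume_ball_real c hh.le, smul_eq_mul, ← hV]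
          field_simp
      _ ≤ _ := by gcongr; linarith
  have h3 := H₂ (q₁ - q₂) (fun i => (MvPolynomial.totalDegree_sub _ _).trans
    (max_le (hq₁ i) (hq₂ i))) c h hh x (hx c hc)
  rw [map_sub, pev_sub] at h3
  refine h3.trans ?_
  have h4 := Finset.sum_le_sum fun i (_ : i ∈ Finset.univ) => hint i
  rw [Finset.sum_const, Finset.card_univ, Fintype.card_fin, nsmul_eq_mul] at h4
  push_cast at h4
  calc _ ≤ C₂ * (h ^ (2 * s))⁻¹ * ((m + 1) * (C₁ * (V + 1) * J)) := by gcongr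
    _ = _ := by ring

end Bound

/-! ### From the local estimate to the whole active domain -/

section Main

variable {m : ℕ}

open Classical in
/-- The stabilized faces contained in a given set. -/
def stabFacesIn (Ω : Set (Vec (m + 1))) (𝒦 : Finset (Set (Vec (m + 1)))) (B : Set (Vec (m + 1))) :
    Finset (Set (Vec (m + 1)) × Set (Vec (m + 1))) :=
  (stabFaces Ω 𝒦).filter fun P => P.1 ∩ P.2 ⊆ B

/-- On each element, an observable is controlled by its values in `Ω` and by the jumps, both taken
within a distance proportional to `h`. -/
lemma IsObservable.exists_local_bound {Ω : Set (Vec (m + 1))} (hΩ : IsLipschitzDomain Ω) {κ h₀ : ℝ}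
    (hκ : 0 < κ) (hh₀ : 0 < h₀) {p s : ℕ}
    {T : (Fin (m + 1) → MvPolynomial (Fin (m + 1)) ℝ) →ₗ[ℝ] MvPolynomial (Fin (m + 1)) ℝ}
    (hT : IsObservable p s T) :
    ∃ C R : ℝ, 0 < C ∧ 1 ≤ R ∧ ∀ h : ℝ, 0 < h → h ≤ h₀ →
      ∀ 𝒦 : Finset (Set (Vec (m + 1))), IsMesh κ h 𝒦 → Ω ⊆ ⋃ K ∈ 𝒦, K →
      ∀ (v : Vec (m + 1) → Vec (m + 1))
        (q : Set (Vec (m + 1)) → Fin (m + 1) → MvPolynomial (Fin (m + 1)) ℝ),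
      (∀ K ∈ activeMesh Ω 𝒦, (∀ i, (q K i).totalDegree ≤ p) ∧ EqOn v (pmap (q K)) K) →
      ∀ K ∈ activeMesh Ω 𝒦, ∃ x ∈ K, ∃ K' ∈ activeMesh Ω 𝒦, ∃ B ⊆ K',
        B ⊆ Metric.closedBall x (R * h) ∩ Ω ∧ ∀ y ∈ K,
          pev (T (q K)) y ^ 2 * h ^ (m + 1) ≤ C * ((∫ w in B, pev (T (q K')) w ^ 2) +
            (h ^ (2 * s))⁻¹ * ∑ P ∈ stabFacesIn Ω 𝒦 (Metric.closedBall x (R * h)),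
              faceTerm p h v P) := by
  classical
  obtain ⟨r, R, hr, hR, hchain⟩ := hΩ.exists_chain hκ hh₀
  -- A point `y` of `K` is within `κ * h` of `x`, and the faces of the chain are within `R * h` of
  -- `x`.
  obtain ⟨C₁, hC₁, H₁⟩ := hT.exists_face_bound hκ (ρ := κ + R) (by linarith)
  obtain ⟨C₂, hC₂, H₂⟩ := exists_pev_sq_le (m + 1) p ((κ + R) / r)
  set N : ℝ := ((R + κ) * κ) ^ (m + 1) with hN
  refine ⟨2 * (C₂ / r ^ (m + 1)) + 2 * (N ^ 2 * C₁), R, by positivity, hR, ?_⟩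
  intro h hh hhh 𝒦 H hcov v q hq K hK
  obtain ⟨x, hxK, K', hK', hreach, z, hz1, hz2⟩ := hchain h hh hhh 𝒦 H hcov K hK
  refine ⟨x, hxK, K', hK', Metric.closedBall z (r * h),
    hz1.trans inter_subset_left, subset_inter hz2 (hz1.trans inter_subset_right), fun y hy => ?_⟩
  set B := Metric.closedBall x (R * h)
  set I := ∫ w in Metric.closedBall z (r * h), pev (T (q K')) w ^ 2 with hI
  set J := ∑ P ∈ stabFacesIn Ω 𝒦 B, faceTerm p h v P with hJ
  have hI0 : 0 ≤ I := integral_nonneg fun _ => sq_nonneg _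
  have hJ0 : 0 ≤ J := Finset.sum_nonneg fun P _ => faceTerm_nonneg p hh.le v P
  have hyx : dist y x ≤ κ * h := H.dist_le (mem_activeMesh.1 hK).1 hy hxK
  have hhp : 0 < h ^ (m + 1) := by positivity
  let S := 𝒦.filter fun K₁ => K₁ ⊆ Metric.closedBall x ((R + κ) * h)
  have hcard : (S.card : ℝ) ≤ N := H.card_le hκ hh (by positivity) S (Finset.filter_subset _ _) x
    fun K₁ h₁ => (Finset.mem_filter.1 h₁).2
  set D := √(C₁ * (h ^ (2 * s))⁻¹ * J / h ^ (m + 1)) with hD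
  -- All polynomials of the chain are evaluated at the same point `y`, although `y` is only known to
  -- lie in `K`; each step costs at most `D`, which contains the whole local jump sum.
  have hvar := abs_sub_le_of_reflTransGen (g := fun K₁ => pev (T (q K₁)) y) (D := D)
    (Real.sqrt_nonneg _) S (fun K₁ K₂ hs => by
      obtain ⟨hs1, hs2⟩ := hs
      obtain ⟨⟨ha₁, ha₂⟩, hne, hsh, -⟩ := mem_stabFaces.1 hs1
      have h₁ := (mem_activeMesh.1 ha₁).1
      have h₂ := (mem_activeMesh.1 ha₂).1
      obtain ⟨c, hc, -⟩ := H.inner_disc K₁ h₁ K₂ h₂ hne hsh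
      refine ⟨Finset.mem_filter.2 ⟨h₁, fun w hw => ?_⟩, ?_⟩
      · have h3 := H.dist_le h₁ hw hc.1
        have h4 := Metric.mem_closedBall.1 (hs2 hc)
        rw [Metric.mem_closedBall]
        linarith [dist_triangle w c x]
      · refine Real.abs_le_sqrt ?_
        rw [le_div_iff₀ hhp]
        refine (H₁ h hh 𝒦 H K₁ h₁ K₂ h₂ hne hsh v _ _ (hq K₁ ha₁).1 (hq K₂ ha₂).1 (hq K₁ ha₁).2
          (hq K₂ ha₂).2 y fun c hc => ?_).trans ?_
        · have h4 := Metric.mem_closedBall.1 (hs2 hc)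
          rw [dist_comm] at h4
          linarith [dist_triangle y x c]
        · gcongr
          exact Finset.single_le_sum (f := fun P => faceTerm p h v P)
            (fun P _ => faceTerm_nonneg p hh.le v P) (Finset.mem_filter.2 ⟨hs1, hs2⟩)) hreach
  have hend := (H₂ (T (q K')) (hT.1 _ (hq K' hK').1) z (r * h) (by positivity) y (by
    have h4 := Metric.mem_closedBall.1 (hz2 (Metric.mem_closedBall_self (by positivity)))
    rw [dist_comm] at h4
    rw [← mul_assoc, div_mul_cancel₀ _ hr.ne']
    linarith [dist_triangle y x z])).1
  rw [← hI, mul_pow] at hend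
  set a := pev (T (q K)) y
  set b := pev (T (q K')) y
  have hb : b ^ 2 * h ^ (m + 1) ≤ C₂ / r ^ (m + 1) * I := by
    rw [div_mul_eq_mul_div, le_div_iff₀ (by positivity)]
    linarith
  have hab : (a - b) ^ 2 * h ^ (m + 1) ≤ N ^ 2 * C₁ * ((h ^ (2 * s))⁻¹ * J) := by
    have h5 : |a - b| ≤ N * D := hvar.trans (mul_le_mul_of_nonneg_right hcard (Real.sqrt_nonneg _))
    have h6 : (a - b) ^ 2 ≤ (N * D) ^ 2 := by
      rw [← sq_abs]; gcongr
    have h7 : D ^ 2 = C₁ * (h ^ (2 * s))⁻¹ * J / h ^ (m + 1) := Real.sq_sqrt (by positivity)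
    calc _ ≤ (N * D) ^ 2 * h ^ (m + 1) := by gcongr
      _ = N ^ 2 * (C₁ * (h ^ (2 * s))⁻¹ * J / h ^ (m + 1)) * h ^ (m + 1) := by rw [mul_pow, h7]
      _ = _ := by field_simp
  have hsq : a ^ 2 ≤ 2 * (a - b) ^ 2 + 2 * b ^ 2 := by nlinarith [sq_nonneg (a - 2 * b)]
  have hsq' := mul_le_mul_of_nonneg_right hsq hhp.le
  have e1 : 0 ≤ N ^ 2 * C₁ * I := by positivity
  have e2 : 0 ≤ C₂ / r ^ (m + 1) * ((h ^ (2 * s))⁻¹ * J) := by positivity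
  nlinarith

/-- The boundary of a convex set is null, so derivatives need only be identified in the interior. -/
lemma IsMesh.ae_eq_of_eqOn_interior {κ h : ℝ} {𝒦 : Finset (Set (Vec (m + 1)))} (H : IsMesh κ h 𝒦)
    {K : Set (Vec (m + 1))} (hK : K ∈ 𝒦) {f g : Vec (m + 1) → ℝ} (hfg : EqOn f g (interior K)) :
    f =ᵐ[volume.restrict K] g := by
  have h1 : interior K =ᵐ[volume] K :=
    interior_ae_eq_of_null_frontier ((H.convex hK).addHaar_frontier volume)
  rw [← Measure.restrict_congr_set h1]
  exact (ae_restrict_mem isOpen_interior.measurableSet).mono hfg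

lemma IsMesh.integrableOn_sq {κ h : ℝ} {𝒦 : Finset (Set (Vec (m + 1)))} (H : IsMesh κ h 𝒦)
    {K : Set (Vec (m + 1))} (hK : K ∈ 𝒦) {f : Vec (m + 1) → ℝ}
    {q : MvPolynomial (Fin (m + 1)) ℝ} (hfq : EqOn f (pev q) (interior K)) :
    IntegrableOn (fun x => f x ^ 2) K :=
  (pev_integrableOn q (H.isCompact hK).isBounded).congr
    (H.ae_eq_of_eqOn_interior hK fun x hx => by simp [hfq hx])

lemma subset_activeDomain {Ω : Set (Vec (m + 1))} {𝒦 : Finset (Set (Vec (m + 1)))}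
    (hcov : Ω ⊆ ⋃ K ∈ 𝒦, K) : Ω ⊆ activeDomain Ω 𝒦 := fun x hx => by
  obtain ⟨K, hK, hxK⟩ := mem_iUnion₂.1 (hcov hx)
  exact mem_iUnion₂.2 ⟨K, mem_activeMesh.2 ⟨hK, x, hxK, hx⟩, hxK⟩

lemma IsMesh.isCompact_activeDomain {κ h : ℝ} {Ω : Set (Vec (m + 1))}
    {𝒦 : Finset (Set (Vec (m + 1)))} (H : IsMesh κ h 𝒦) : IsCompact (activeDomain Ω 𝒦) :=
  (activeMesh Ω 𝒦).finite_toSet.isCompact_biUnion fun _ hK =>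
    H.isCompact (mem_activeMesh.1 hK).1

lemma IsMesh.integrableOn_activeDomain {κ h : ℝ} {Ω : Set (Vec (m + 1))}
    {𝒦 : Finset (Set (Vec (m + 1)))} (H : IsMesh κ h 𝒦) {f : Vec (m + 1) → ℝ}
    {q : Set (Vec (m + 1)) → MvPolynomial (Fin (m + 1)) ℝ}
    (hfq : ∀ K ∈ activeMesh Ω 𝒦, EqOn f (pev (q K)) (interior K)) :
    IntegrableOn (fun x => f x ^ 2) (activeDomain Ω 𝒦) := by
  rw [activeDomain, integrableOn_finset_iUnion]
  exact fun K hK => H.integrableOn_sq (mem_activeMesh.1 hK).1 (hfq K hK)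

/-- The inverse estimate for observables. -/
lemma IsObservable.exists_bound {Ω : Set (Vec (m + 1))} (hΩ : IsLipschitzDomain Ω) {κ h₀ : ℝ}
    (hκ : 0 < κ) (hh₀ : 0 < h₀) {p s : ℕ}
    {T : (Fin (m + 1) → MvPolynomial (Fin (m + 1)) ℝ) →ₗ[ℝ] MvPolynomial (Fin (m + 1)) ℝ}
    (hT : IsObservable p s T) :
    ∃ C : ℝ, 0 < C ∧ ∀ h : ℝ, 0 < h → h ≤ h₀ →
      ∀ 𝒦 : Finset (Set (Vec (m + 1))), IsMesh κ h 𝒦 → Ω ⊆ ⋃ K ∈ 𝒦, K →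
      ∀ (v : Vec (m + 1) → Vec (m + 1))
        (q : Set (Vec (m + 1)) → Fin (m + 1) → MvPolynomial (Fin (m + 1)) ℝ),
      (∀ K ∈ activeMesh Ω 𝒦, (∀ i, (q K i).totalDegree ≤ p) ∧ EqOn v (pmap (q K)) K) →
      ∀ f : Vec (m + 1) → ℝ, (∀ K ∈ activeMesh Ω 𝒦, EqOn f (pev (T (q K))) (interior K)) →
        ∫ x in activeDomain Ω 𝒦, f x ^ 2 ≤
          C * ((∫ x in Ω, f x ^ 2) + (h ^ (2 * s))⁻¹ * jForm p h Ω 𝒦 v v) := by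
  classical
  obtain ⟨C, R, hC, hR, hloc⟩ := hT.exists_local_bound hΩ hκ hh₀
  set V := volume.real (Metric.ball (0 : Vec (m + 1)) 1) with hV
  set N : ℝ := ((R + κ) * κ) ^ (m + 1) with hN
  refine ⟨2 * (C * κ ^ (m + 1) * (V + 1) * N), by positivity, ?_⟩
  intro h hh hhh 𝒦 H hcov v q hq f hf
  choose! x hxK K' hK' B hBK' hBΩ hbound using hloc h hh hhh 𝒦 H hcov v q hq
  set J : Set (Vec (m + 1)) → ℝ := fun K =>
    ∑ P ∈ stabFacesIn Ω 𝒦 (Metric.closedBall (x K) (R * h)), faceTerm p h v P with hJ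
  have hact : ∀ K ∈ activeMesh Ω 𝒦, K ∈ 𝒦 := fun K hK => (mem_activeMesh.1 hK).1
  have hfN : IntegrableOn (fun x => f x ^ 2) (activeDomain Ω 𝒦) := H.integrableOn_activeDomain hf
  have hfΩ : IntegrableOn (fun x => f x ^ 2) Ω := hfN.mono_set (subset_activeDomain hcov)
  have hhs : 0 < (h ^ (2 * s))⁻¹ := by positivity
  have hJ0 : ∀ K, 0 ≤ J K := fun K =>
    Finset.sum_nonneg fun P _ => faceTerm_nonneg p hh.le v P
  have hK : ∀ K ∈ activeMesh Ω 𝒦, ∫ y in K, f y ^ 2 ≤ C * κ ^ (m + 1) * (V + 1) *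
      ((∫ w in Ω, (Metric.closedBall (x K) (R * h)).indicator (fun w => f w ^ 2) w) +
        (h ^ (2 * s))⁻¹ * J K) := by
    intro K hK
    have hKm : MeasurableSet K := (H.isCompact (hact K hK)).isClosed.measurableSet
    have hI : ∫ w in B K, pev (T (q (K' K))) w ^ 2 ≤
        ∫ w in Ω, (Metric.closedBall (x K) (R * h)).indicator (fun w => f w ^ 2) w := by
      rw [setIntegral_indicator Metric.isClosed_closedBall.measurableSet, inter_comm]
      have hae := ae_restrict_of_ae_restrict_of_subset (hBK' K hK)
        (H.ae_eq_of_eqOn_interior (hact _ (hK' K hK)) (hf _ (hK' K hK)))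
      rw [← integral_congr_ae (hae.mono fun w hw =>
        show f w ^ 2 = pev (T (q (K' K))) w ^ 2 by rw [hw])]
      exact setIntegral_mono_set (hfΩ.mono_set inter_subset_right)
        (Eventually.of_forall fun w => sq_nonneg _) (LE.le.eventuallyLE (hBΩ K hK))
    set I := ∫ w in Ω, (Metric.closedBall (x K) (R * h)).indicator (fun w => f w ^ 2) w
    have hI0 : 0 ≤ I := integral_nonneg fun w => indicator_nonneg (fun _ _ => sq_nonneg _) w
    have hle : ∀ y ∈ K, pev (T (q K)) y ^ 2 ≤
        C * (I + (h ^ (2 * s))⁻¹ * J K) / h ^ (m + 1) := by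
      intro y hy
      rw [le_div_iff₀ (by positivity)]
      refine (hbound K hK y hy).trans ?_
      gcongr
    have hvol : volume.real K ≤ (κ * h) ^ (m + 1) * V := by
      rw [hV, ← volume_ball_real (x K) (by positivity)]
      exact measureReal_mono (fun y hy => H.dist_le (hact K hK) hy (hxK K hK))
        Metric.isBounded_closedBall.measure_lt_top.ne
    have hIJ : 0 ≤ I + (h ^ (2 * s))⁻¹ * J K := add_nonneg hI0 (mul_nonneg hhs.le (hJ0 K))
    rw [integral_congr_ae ((H.ae_eq_of_eqOn_interior (hact K hK) (hf K hK)).mono fun w hw =>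
      show f w ^ 2 = pev (T (q K)) w ^ 2 by rw [hw])]
    calc _ ≤ ∫ y in K, C * (I + (h ^ (2 * s))⁻¹ * J K) / h ^ (m + 1) :=
          setIntegral_mono_on (pev_integrableOn _ (H.isCompact (hact K hK)).isBounded)
            (integrableOn_const (H.isCompact (hact K hK)).measure_lt_top.ne) hKm hle
      _ = volume.real K * (C * (I + (h ^ (2 * s))⁻¹ * J K) / h ^ (m + 1)) := by
          rw [setIntegral_const, smul_eq_mul]
      _ ≤ ((κ * h) ^ (m + 1) * (V + 1)) * (C * (I + (h ^ (2 * s))⁻¹ * J K) / h ^ (m + 1)) := by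
          gcongr
          refine hvol.trans ?_
          gcongr
          linarith
      _ = _ := by rw [mul_pow]; field_simp
  -- Bounded overlap: an element whose ball contains `w` lies within `(R + κ) * h` of `w`, so
  -- packing applies.
  have hcount : ∀ w : Vec (m + 1), (((activeMesh Ω 𝒦).filter fun K =>
      w ∈ Metric.closedBall (x K) (R * h)).card : ℝ) ≤ N := by
    intro w
    refine H.card_le hκ hh (by positivity) _
      (fun K hK => hact K (Finset.mem_filter.1 hK).1) w fun K hK y hy => ?_
    obtain ⟨hK1, hK2⟩ := Finset.mem_filter.1 hK
    have h1 := H.dist_le (hact K hK1) hy (hxK K hK1)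
    rw [Metric.mem_closedBall, dist_comm] at hK2
    rw [Metric.mem_closedBall]
    linarith [dist_triangle y (x K) w]
  have hsumI : ∑ K ∈ activeMesh Ω 𝒦,
      ∫ w in Ω, (Metric.closedBall (x K) (R * h)).indicator (fun w => f w ^ 2) w ≤
        N * ∫ w in Ω, f w ^ 2 := by
    have hind : ∀ K, IntegrableOn
        ((Metric.closedBall (x K) (R * h)).indicator (fun w => f w ^ 2)) Ω := fun K =>
      Integrable.indicator hfΩ Metric.isClosed_closedBall.measurableSet
    rw [← integral_finsetSum _ fun K _ => hind K, ← integral_const_mul]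
    refine integral_mono (integrable_finsetSum _ fun K _ => hind K) (hfΩ.const_mul N) fun w => ?_
    simp only [indicator_apply]
    rw [← Finset.sum_filter, Finset.sum_const, nsmul_eq_mul]
    exact mul_le_mul_of_nonneg_right (hcount w) (sq_nonneg _)
  -- A face counted for `K` lies in the ball about `x K`, so `hcount` at one of its points bounds
  -- its multiplicity. The factor `2` undoes the `1 / 2` in `jForm`.
  have hsumJ : ∑ K ∈ activeMesh Ω 𝒦, J K ≤ N * (2 * jForm p h Ω 𝒦 v v) := by
    rw [jForm_eq]
    simp only [hJ, stabFacesIn, Finset.sum_filter]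
    rw [Finset.sum_comm, ← mul_assoc 2, mul_one_div_cancel two_ne_zero, one_mul, Finset.mul_sum]
    refine Finset.sum_le_sum fun P hP => ?_
    rw [← Finset.sum_filter, Finset.sum_const, nsmul_eq_mul]
    refine mul_le_mul_of_nonneg_right ?_ (faceTerm_nonneg p hh.le v P)
    obtain ⟨⟨ha₁, ha₂⟩, hne, hsh, -⟩ := mem_stabFaces.1 hP
    obtain ⟨c, hc, -⟩ := H.inner_disc P.1 (hact _ ha₁) P.2 (hact _ ha₂) hne hsh
    refine le_trans ?_ (hcount c)
    refine Nat.cast_le.2 (Finset.card_le_card fun K hK => ?_)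
    rw [Finset.mem_filter] at hK ⊢
    exact ⟨hK.1, hK.2 hc⟩
  have hunion : ∫ y in activeDomain Ω 𝒦, f y ^ 2 ≤ ∑ K ∈ activeMesh Ω 𝒦, ∫ y in K, f y ^ 2 := by
    have hKm : ∀ K ∈ activeMesh Ω 𝒦, MeasurableSet K := fun K hK =>
      (H.isCompact (hact K hK)).isClosed.measurableSet
    have hKi : ∀ K ∈ activeMesh Ω 𝒦, Integrable (K.indicator fun y => f y ^ 2) := fun K hK =>
      (integrable_indicator_iff (hKm K hK)).2 (H.integrableOn_sq (hact K hK) (hf K hK))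
    have hNm : MeasurableSet (activeDomain Ω 𝒦) := H.isCompact_activeDomain.isClosed.measurableSet
    rw [← integral_indicator hNm, Finset.sum_congr rfl fun K hK =>
      (integral_indicator (hKm K hK) (f := fun y => f y ^ 2)).symm, ← integral_finsetSum _ hKi]
    refine integral_mono ((integrable_indicator_iff hNm).2 hfN)
      (integrable_finsetSum _ hKi) fun y => ?_
    have hnn : ∀ K : Set (Vec (m + 1)), 0 ≤ K.indicator (fun y => f y ^ 2) y := fun K =>
      indicator_nonneg (fun _ _ => sq_nonneg _) y
    by_cases hy : y ∈ activeDomain Ω 𝒦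
    · obtain ⟨K, hK, hyK⟩ := mem_iUnion₂.1 hy
      rw [indicator_of_mem hy, ← indicator_of_mem hyK fun y => f y ^ 2]
      exact Finset.single_le_sum (f := fun K => K.indicator (fun y => f y ^ 2) y)
        (fun K _ => hnn K) hK
    · rw [indicator_of_notMem hy]
      exact Finset.sum_nonneg fun K _ => hnn K
  have hM : 0 ≤ C * κ ^ (m + 1) * (V + 1) := by positivity
  have hΩ0 : 0 ≤ ∫ w in Ω, f w ^ 2 := integral_nonneg fun _ => sq_nonneg _
  have hN0 : 0 ≤ N := by positivity
  calc _ ≤ _ := hunion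
    _ ≤ _ := Finset.sum_le_sum hK
    _ = C * κ ^ (m + 1) * (V + 1) * ((∑ K ∈ activeMesh Ω 𝒦,
        ∫ w in Ω, (Metric.closedBall (x K) (R * h)).indicator (fun w => f w ^ 2) w) +
          (h ^ (2 * s))⁻¹ * ∑ K ∈ activeMesh Ω 𝒦, J K) := by
        rw [← Finset.mul_sum, Finset.sum_add_distrib, ← Finset.mul_sum]
    _ ≤ C * κ ^ (m + 1) * (V + 1) * (2 * (N * ∫ w in Ω, f w ^ 2) +
          (h ^ (2 * s))⁻¹ * (N * (2 * jForm p h Ω 𝒦 v v))) := by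
        gcongr
        exact hsumI.trans (le_mul_of_one_le_left (mul_nonneg hN0 hΩ0) one_le_two)
    _ = _ := by ring

end Main

/-! ### Application to the field, gradient and strain, and comparison of the forms -/

section Final

variable {m : ℕ}

lemma jForm_nonneg (p : ℕ) {h : ℝ} (hh : 0 ≤ h) (Ω : Set (Vec (m + 1)))
    (𝒦 : Finset (Set (Vec (m + 1)))) (v : Vec (m + 1) → Vec (m + 1)) :
    0 ≤ jForm p h Ω 𝒦 v v := by
  rw [jForm_eq]
  exact mul_nonneg (by norm_num) (Finset.sum_nonneg fun P _ => faceTerm_nonneg p hh v P)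

/-- The inverse estimate for finite families of observables. -/
lemma exists_bound_of_isObservable {Ω : Set (Vec (m + 1))} (hΩ : IsLipschitzDomain Ω) {κ h₀ : ℝ}
    (hκ : 0 < κ) (hh₀ : 0 < h₀) {p s : ℕ} {ι : Type*} [Fintype ι]
    {T : ι → (Fin (m + 1) → MvPolynomial (Fin (m + 1)) ℝ) →ₗ[ℝ] MvPolynomial (Fin (m + 1)) ℝ}
    (hT : ∀ a, IsObservable p s (T a)) :
    ∃ C : ℝ, 0 < C ∧ ∀ h : ℝ, 0 < h → h ≤ h₀ →
      ∀ 𝒦 : Finset (Set (Vec (m + 1))), IsMesh κ h 𝒦 → Ω ⊆ ⋃ K ∈ 𝒦, K →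
      ∀ (v : Vec (m + 1) → Vec (m + 1))
        (q : Set (Vec (m + 1)) → Fin (m + 1) → MvPolynomial (Fin (m + 1)) ℝ),
      (∀ K ∈ activeMesh Ω 𝒦, (∀ i, (q K i).totalDegree ≤ p) ∧ EqOn v (pmap (q K)) K) →
      ∀ f : ι → Vec (m + 1) → ℝ,
        (∀ a, ∀ K ∈ activeMesh Ω 𝒦, EqOn (f a) (pev (T a (q K))) (interior K)) →
        IntegrableOn (fun x => ∑ a, f a x ^ 2) (activeDomain Ω 𝒦) ∧
        ∫ x in activeDomain Ω 𝒦, ∑ a, f a x ^ 2 ≤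
          C * ((∫ x in Ω, ∑ a, f a x ^ 2) + (h ^ (2 * s))⁻¹ * jForm p h Ω 𝒦 v v) := by
  choose C hC hbound using fun a => (hT a).exists_bound hΩ hκ hh₀
  refine ⟨∑ a, C a + 1, add_pos_of_nonneg_of_pos (Finset.sum_nonneg fun a _ => (hC a).le) one_pos,
    ?_⟩
  intro h hh hhh 𝒦 H hcov v q hq f hf
  have hi : ∀ a, IntegrableOn (fun x => f a x ^ 2) (activeDomain Ω 𝒦) := fun a =>
    H.integrableOn_activeDomain (hf a)
  have hiΩ : ∀ a, IntegrableOn (fun x => f a x ^ 2) Ω := fun a =>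
    (hi a).mono_set (subset_activeDomain hcov)
  refine ⟨integrable_finsetSum _ fun a _ => hi a, ?_⟩
  set J := (h ^ (2 * s))⁻¹ * jForm p h Ω 𝒦 v v with hJdef
  have hJ' : 0 ≤ J := mul_nonneg (by positivity) (jForm_nonneg p hh.le Ω 𝒦 v)
  rw [integral_finsetSum _ fun a _ => hi a, integral_finsetSum _ fun a _ => hiΩ a]
  have hnn : ∀ a, 0 ≤ ∫ x in Ω, f a x ^ 2 := fun a => integral_nonneg fun _ => sq_nonneg _
  have hS : 0 ≤ ∑ a, ∫ x in Ω, f a x ^ 2 := Finset.sum_nonneg fun a _ => hnn a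
  calc _ ≤ ∑ a, C a * ((∑ a, ∫ x in Ω, f a x ^ 2) + J) :=
        Finset.sum_le_sum fun a _ => (hbound a h hh hhh 𝒦 H hcov v q hq (f a) (hf a)).trans
          (mul_le_mul_of_nonneg_left (add_le_add (Finset.single_le_sum
            (f := fun a => ∫ x in Ω, f a x ^ 2) (fun a _ => hnn a) (Finset.mem_univ a)) le_rfl)
            (hC a).le)
    _ ≤ _ := by
        rw [← Finset.sum_mul]
        gcongr
        linarith

lemma exists_polynomials {p : ℕ} {Ω : Set (Vec (m + 1))} {𝒦 : Finset (Set (Vec (m + 1)))}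
    {v : Vec (m + 1) → Vec (m + 1)} (hv : v ∈ feSpace p Ω 𝒦) :
    ∃ q : Set (Vec (m + 1)) → Fin (m + 1) → MvPolynomial (Fin (m + 1)) ℝ,
      ∀ K ∈ activeMesh Ω 𝒦, (∀ i, (q K i).totalDegree ≤ p) ∧ EqOn v (pmap (q K)) K := by
  obtain ⟨w, ⟨-, hw⟩, hvw⟩ := hv
  choose! q hq1 hq2 using hw
  refine ⟨q, fun K hK => ⟨hq1 K (mem_activeMesh.1 hK).1, fun x hx => ?_⟩⟩
  rw [hvw (mem_iUnion₂.2 ⟨K, hK, hx⟩)]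
  ext i
  exact hq2 K (mem_activeMesh.1 hK).1 x hx i

lemma grad_apply_of_eqOn {K : Set (Vec (m + 1))} {v : Vec (m + 1) → Vec (m + 1)}
    {q : Fin (m + 1) → MvPolynomial (Fin (m + 1)) ℝ} (hv : EqOn v (pmap q) K) {x : Vec (m + 1)}
    (hx : x ∈ interior K) (i j : Fin (m + 1)) :
    grad v x i j = pev (MvPolynomial.pderiv j (q i)) x := by
  have he : v =ᶠ[𝓝 x] pmap q := hv.eventuallyEq_of_mem (mem_interior_iff_mem_nhds.1 hx)
  have hd : DifferentiableAt ℝ (pmap q) x := (contDiff_pmap q (k := 1)).differentiable (by simp) x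
  have hc : pev (q i) = (EuclideanSpace.proj i : Vec (m + 1) →L[ℝ] ℝ) ∘ pmap q := by
    ext x; simp [pmap]
  rw [grad, Matrix.of_apply, he.fderiv_eq, ← fderiv_pev_single, hc,
    fderiv_comp x (ContinuousLinearMap.differentiableAt _) hd, ContinuousLinearMap.fderiv]
  rfl

lemma frob_self (A : Matrix (Fin m) (Fin m) ℝ) : frob A A = ∑ a : Fin m × Fin m, A a.1 a.2 ^ 2 := by
  simp [frob, Fintype.sum_prod_type, sq]

lemma frob_self_nonneg (A : Matrix (Fin m) (Fin m) ℝ) : 0 ≤ frob A A := by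
  rw [frob_self]; positivity

lemma trace_mul_trace_le (A : Matrix (Fin m) (Fin m) ℝ) : A.trace * A.trace ≤ m * frob A A := by
  rw [Matrix.trace, ← sq]
  refine sq_sum_le_card_mul_sum_sq.trans ?_
  rw [Finset.card_univ, Fintype.card_fin, frob]
  gcongr with i hi
  rw [Matrix.diag_apply, sq]
  exact Finset.single_le_sum (f := fun j => A i j * A i j) (fun j _ => mul_self_nonneg _)
    (Finset.mem_univ i)

lemma frob_strain_le (v : Vec m → Vec m) (x : Vec m) :
    frob (strain v x) (strain v x) ≤ frob (grad v x) (grad v x) := by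
  set A := grad v x
  have h1 : frob (strain v x) (strain v x) ≤
      ∑ i, ∑ j, (1 / 2 * (A i j * A i j) + 1 / 2 * (A j i * A j i)) := by
    refine Finset.sum_le_sum fun i _ => Finset.sum_le_sum fun j _ => ?_
    simp only [strain, Matrix.smul_apply, Matrix.add_apply, Matrix.transpose_apply, smul_eq_mul]
    nlinarith [sq_nonneg (A i j - A j i)]
  refine h1.trans (le_of_eq ?_)
  simp only [Finset.sum_add_distrib, ← Finset.mul_sum]
  rw [Finset.sum_comm (f := fun i j => A j i * A j i), frob]
  ring

lemma norm_outerNormal_le (Ω : Set (Vec m)) (x : Vec m) : ‖outerNormal Ω x‖ ≤ 1 := by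
  classical
  unfold outerNormal
  split_ifs with h
  · exact h.choose_spec.1.le
  · simp

/-- For negative `lam` one uses `(v·n)² ≤ |v|²` and `2μ + lam ≥ 2μ + m * lam > 0`. Default values in
the normal, the stress trace or a nonintegrable integral do no harm, since only nonnegativity is
needed. -/
lemma boundaryNormSq_nonneg {μ lam : ℝ} (hμ : 0 < μ) (hlam : 0 < 2 * μ + m * lam) (hm : 1 ≤ m)
    {h : ℝ} (hh : 0 < h) (Ω ΓD : Set (Vec m)) (v : Vec m → Vec m) :
    0 ≤ boundaryNormSq μ lam h Ω ΓD v := by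
  refine add_nonneg (mul_nonneg hh.le (integral_nonneg fun x => frob_self_nonneg _))
    (mul_nonneg (by positivity) (integral_nonneg fun x => ?_))
  set n := outerNormal Ω x
  have h1 : inner ℝ (v x) n * inner ℝ (v x) n ≤ inner ℝ (v x) (v x) := by
    have h2 : |inner ℝ (v x) n| ≤ ‖v x‖ := (abs_real_inner_le_norm _ _).trans
      (mul_le_of_le_one_right (norm_nonneg _) (norm_outerNormal_le Ω x))
    rw [real_inner_self_eq_norm_sq, ← sq, ← sq_abs]
    gcongr
  have h0 : 0 ≤ inner ℝ (v x) n * inner ℝ (v x) n := mul_self_nonneg _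
  have hm' : (1 : ℝ) ≤ m := by exact_mod_cast hm
  change 0 ≤ 2 * μ * inner ℝ (v x) (v x) + lam * (inner ℝ (v x) n * inner ℝ (v x) n)
  generalize inner ℝ (v x) n * inner ℝ (v x) n = b at *
  generalize (inner ℝ (v x) (v x) : ℝ) = a at *
  rcases le_total 0 lam with hl | hl
  · nlinarith [mul_nonneg hl h0, mul_nonneg hμ.le (h0.trans h1)]
  · have : 0 ≤ 2 * μ + lam := by nlinarith
    nlinarith [mul_nonneg this h0, mul_nonneg hμ.le (sub_nonneg.2 h1)]

lemma l2Trace_nonneg (ω : Set (Vec m)) (v : Vec m → Vec m) : 0 ≤ l2Trace ω v v :=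
  integral_nonneg fun _ => mul_self_nonneg _

lemma l2Strain_nonneg (ω : Set (Vec m)) (v : Vec m → Vec m) : 0 ≤ l2Strain ω v v :=
  integral_nonneg fun _ => frob_self_nonneg _

lemma l2Trace_le {ω : Set (Vec m)} {v : Vec m → Vec m}
    (hv : IntegrableOn (fun x => frob (strain v x) (strain v x)) ω) :
    l2Trace ω v v ≤ m * l2Strain ω v v := by
  rw [l2Trace, l2Strain, ← integral_const_mul]
  exact integral_mono_of_nonneg (Eventually.of_forall fun _ => mul_self_nonneg _)
    (hv.const_mul _) (Eventually.of_forall fun _ => trace_mul_trace_le _)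

lemma aForm_le {μ lam : ℝ} {ω : Set (Vec m)} {v : Vec m → Vec m}
    (hv : IntegrableOn (fun x => frob (strain v x) (strain v x)) ω) :
    aForm μ lam ω v v ≤ (2 * μ + |lam| * m) * l2Strain ω v v := by
  have h1 := l2Trace_le hv
  have h2 := l2Trace_nonneg ω v
  rw [aForm]
  nlinarith [mul_le_mul_of_nonneg_right (le_abs_self lam) h2,
    mul_le_mul_of_nonneg_left h1 (abs_nonneg lam)]

/-- By Cauchy–Schwarz the squared trace is at most `m` times the squared strain, so a negative `lam`
lowers the coefficient `2μ` to no less than `2μ + m * lam`. -/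
lemma le_aForm {μ lam : ℝ} {ω : Set (Vec m)} {v : Vec m → Vec m}
    (hv : IntegrableOn (fun x => frob (strain v x) (strain v x)) ω) :
    min (2 * μ) (2 * μ + m * lam) * l2Strain ω v v ≤ aForm μ lam ω v v := by
  have h1 := l2Trace_le hv
  have h2 := l2Trace_nonneg ω v
  have h3 := l2Strain_nonneg ω v
  rw [aForm]
  rcases le_total 0 lam with hl | hl
  · have := mul_le_mul_of_nonneg_right (min_le_left (2 * μ) (2 * μ + m * lam)) h3
    nlinarith [mul_nonneg hl h2]
  · have := mul_le_mul_of_nonneg_right (min_le_right (2 * μ) (2 * μ + m * lam)) h3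
    nlinarith [mul_le_mul_of_nonpos_left h1 hl]

lemma exists_l2Vec_bound {Ω : Set (Vec (m + 1))} (hΩ : IsLipschitzDomain Ω) {κ h₀ : ℝ}
    (hκ : 0 < κ) (hh₀ : 0 < h₀) (p : ℕ) :
    ∃ C : ℝ, 0 < C ∧ ∀ h : ℝ, 0 < h → h ≤ h₀ →
      ∀ 𝒦 : Finset (Set (Vec (m + 1))), IsMesh κ h 𝒦 → Ω ⊆ ⋃ K ∈ 𝒦, K →
      ∀ v ∈ feSpace p Ω 𝒦,
        l2Vec (activeDomain Ω 𝒦) v v ≤ C * (l2Vec Ω v v + jForm p h Ω 𝒦 v v) := by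
  obtain ⟨C, hC, H⟩ := exists_bound_of_isObservable hΩ hκ hh₀
    (fun i : Fin (m + 1) => isObservable_proj p i)
  refine ⟨C, hC, fun h hh hhh 𝒦 hM hcov v hv => ?_⟩
  obtain ⟨q, hq⟩ := exists_polynomials hv
  have := (H h hh hhh 𝒦 hM hcov v q hq (fun i x => v x i) fun i K hK x hx => by
    simp [(hq K hK).2 (interior_subset hx), pmap]).2
  have e : ∀ x, inner ℝ (v x) (v x) = ∑ i, v x i ^ 2 := fun x => by
    rw [real_inner_self_eq_norm_sq, EuclideanSpace.real_norm_sq_eq]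
  simp only [l2Vec, e]
  simpa using this

lemma exists_l2Grad_bound {Ω : Set (Vec (m + 1))} (hΩ : IsLipschitzDomain Ω) {κ h₀ : ℝ}
    (hκ : 0 < κ) (hh₀ : 0 < h₀) (p : ℕ) :
    ∃ C : ℝ, 0 < C ∧ ∀ h : ℝ, 0 < h → h ≤ h₀ →
      ∀ 𝒦 : Finset (Set (Vec (m + 1))), IsMesh κ h 𝒦 → Ω ⊆ ⋃ K ∈ 𝒦, K →
      ∀ v ∈ feSpace p Ω 𝒦,
        IntegrableOn (fun x => frob (grad v x) (grad v x)) (activeDomain Ω 𝒦) ∧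
        l2Grad (activeDomain Ω 𝒦) v v ≤
          C * (l2Grad Ω v v + (h ^ 2)⁻¹ * jForm p h Ω 𝒦 v v) := by
  obtain ⟨C, hC, H⟩ := exists_bound_of_isObservable hΩ hκ hh₀
    (fun a : Fin (m + 1) × Fin (m + 1) => isObservable_pderiv p a.1 a.2)
  refine ⟨C, hC, fun h hh hhh 𝒦 hM hcov v hv => ?_⟩
  obtain ⟨q, hq⟩ := exists_polynomials hv
  have := H h hh hhh 𝒦 hM hcov v q hq (fun a x => grad v x a.1 a.2) fun a K hK x hx => by
    simp [grad_apply_of_eqOn (hq K hK).2 hx]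
  simpa only [l2Grad, frob_self] using this

/-- Each strain entry is itself an observable of order one, so only the strain in `Ω`, and not the
full gradient, appears on the right. -/
lemma exists_l2Strain_bound {Ω : Set (Vec (m + 1))} (hΩ : IsLipschitzDomain Ω) {κ h₀ : ℝ}
    (hκ : 0 < κ) (hh₀ : 0 < h₀) (p : ℕ) :
    ∃ C : ℝ, 0 < C ∧ ∀ h : ℝ, 0 < h → h ≤ h₀ →
      ∀ 𝒦 : Finset (Set (Vec (m + 1))), IsMesh κ h 𝒦 → Ω ⊆ ⋃ K ∈ 𝒦, K →
      ∀ v ∈ feSpace p Ω 𝒦,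
        IntegrableOn (fun x => frob (strain v x) (strain v x)) (activeDomain Ω 𝒦) ∧
        l2Strain (activeDomain Ω 𝒦) v v ≤
          C * (l2Strain Ω v v + (h ^ 2)⁻¹ * jForm p h Ω 𝒦 v v) := by
  obtain ⟨C, hC, H⟩ := exists_bound_of_isObservable hΩ hκ hh₀
    (fun a : Fin (m + 1) × Fin (m + 1) =>
      ((isObservable_pderiv p a.1 a.2).add (isObservable_pderiv p a.2 a.1)).smul (1 / 2))
  refine ⟨C, hC, fun h hh hhh 𝒦 hM hcov v hv => ?_⟩
  obtain ⟨q, hq⟩ := exists_polynomials hv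
  have := H h hh hhh 𝒦 hM hcov v q hq (fun a x => strain v x a.1 a.2) fun a K hK x hx => by
    simp [strain, grad_apply_of_eqOn (hq K hK).2 hx, mul_add]
  simpa only [l2Strain, frob_self] using this

/-- Converts the unit weight of the jump term into the stabilization parameter. -/
lemma add_le_mul_add {γ a b : ℝ} (hγ : 0 < γ) (ha : 0 ≤ a) (hb : 0 ≤ b) :
    a + b ≤ (1 + γ⁻¹) * (a + γ * b) := by
  have h1 : γ⁻¹ * (γ * b) = b := inv_mul_cancel_left₀ hγ.ne' b
  rw [add_mul, one_mul, mul_add γ⁻¹, h1]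
  have : 0 ≤ γ⁻¹ * a := by positivity
  have : 0 ≤ γ * b := by positivity
  linarith

end Final

end CutFEM

end

open CutFEM
theorem mainTheorem3 (d : ℕ) (hd : d = 2 ∨ d = 3)
    (Ω : Set (Vec d)) (hΩ : IsLipschitzDomain Ω)
    (μ lam : ℝ) (hμ : 0 < μ) (hlam : 0 < 2 * μ + d * lam)
    (γm γa : ℝ) (hγm : 0 < γm) (hγa : 0 < γa)
    (p : ℕ) (κ : ℝ) (hκ : 0 < κ) (h₀ : ℝ) (hh₀ : 0 < h₀) :
    ∃ C : ℝ, 0 < C ∧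
      ∀ h : ℝ, 0 < h → h ≤ h₀ →
      ∀ 𝒦 : Finset (Set (Vec d)), IsMesh κ h 𝒦 → Ω ⊆ ⋃ K ∈ 𝒦, K →
      ∀ ΓD : Set (Vec d), ΓD ⊆ frontier Ω → MeasurableSet ΓD →
      ∀ v ∈ feSpace p Ω 𝒦,
        √(l2Vec (activeDomain Ω 𝒦) v v) ≤ C * √(mhForm γm p h Ω 𝒦 v v) ∧
        √(l2Grad (activeDomain Ω 𝒦) v v) ≤ C * √(ahGradNormSq γa p h Ω 𝒦 v) ∧
        aForm μ lam (activeDomain Ω 𝒦) v v ≤ C * tripleNormSq μ lam γa p h Ω ΓD 𝒦 v ∧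
        aForm μ lam (activeDomain Ω 𝒦) v v ≤ C * tripleGradNormSq μ lam γa p h Ω ΓD 𝒦 v := by
  -- Writing `d = m + 1` turns the face measure `μHE[d - 1]` into `μHE[m]` by reduction.
  obtain ⟨m, rfl⟩ : ∃ m, d = m + 1 := ⟨d - 1, by omega⟩
  obtain ⟨C₁, hC₁, H₁⟩ := exists_l2Vec_bound hΩ hκ hh₀ p
  obtain ⟨C₂, hC₂, H₂⟩ := exists_l2Grad_bound hΩ hκ hh₀ p
  obtain ⟨C₃, hC₃, H₃⟩ := exists_l2Strain_bound hΩ hκ hh₀ p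
  set c := min (2 * μ) (2 * μ + ((m + 1 : ℕ) : ℝ) * lam) with hc
  have hc0 : 0 < c := lt_min (by positivity) hlam
  set A := 2 * μ + |lam| * ((m + 1 : ℕ) : ℝ) with hA
  have hA0 : 0 < A := by positivity
  set B₁ := C₁ * (1 + γm⁻¹) with hB₁
  set B₂ := C₂ * (1 + γa⁻¹) with hB₂
  -- Factoring the coercivity constant `c` out of `a_h` leaves the jump weight `γa / c`.
  set B₃ := A * C₃ * (c⁻¹ * (1 + (γa / c)⁻¹)) with hB₃
  set B₄ := A * C₃ * (1 + γa⁻¹) with hB₄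
  have hB₁0 : 0 < B₁ := by positivity
  have hB₂0 : 0 < B₂ := by positivity
  have hB₃0 : 0 < B₃ := by positivity
  have hB₄0 : 0 < B₄ := by positivity
  -- Square roots appear for the two bounds on norms, none for the bounds on quadratic forms; the
  -- sum serves all four.
  refine ⟨√B₁ + √B₂ + B₃ + B₄, by positivity, ?_⟩
  intro h hh hhh 𝒦 hM hcov ΓD _ _ v hv
  have h1 := H₁ h hh hhh 𝒦 hM hcov v hv
  obtain ⟨hgi, h2⟩ := H₂ h hh hhh 𝒦 hM hcov v hv
  obtain ⟨hsi, h3⟩ := H₃ h hh hhh 𝒦 hM hcov v hv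
  have hJ := jForm_nonneg p hh.le Ω 𝒦 v
  have hJ' : 0 ≤ (h ^ 2)⁻¹ * jForm p h Ω 𝒦 v v := mul_nonneg (by positivity) hJ
  have hbd := boundaryNormSq_nonneg hμ hlam (by omega) hh Ω ΓD v
  have hv0 : 0 ≤ l2Vec Ω v v := integral_nonneg fun _ => real_inner_self_nonneg
  have hg0 : 0 ≤ l2Grad Ω v v := integral_nonneg fun _ => frob_self_nonneg _
  have hs0 := l2Strain_nonneg Ω v
  have hΩN := subset_activeDomain hcov
  have hsg : l2Strain Ω v v ≤ l2Grad Ω v v :=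
    setIntegral_mono (hsi.mono_set hΩN) (hgi.mono_set hΩN) fun x => frob_strain_le v x
  have hlow : c * l2Strain Ω v v ≤ aForm μ lam Ω v v := le_aForm (hsi.mono_set hΩN)
  have hup : aForm μ lam (activeDomain Ω 𝒦) v v ≤
      A * C₃ * (l2Strain Ω v v + (h ^ 2)⁻¹ * jForm p h Ω 𝒦 v v) := by
    refine (aForm_le hsi).trans ?_
    rw [mul_assoc]
    exact mul_le_mul_of_nonneg_left h3 hA0.le
  have hAC : 0 ≤ A * C₃ := by positivity
  have hR₁ := Real.sqrt_nonneg B₁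
  have hR₂ := Real.sqrt_nonneg B₂
  refine ⟨?_, ?_, ?_, ?_⟩
  · have h5 : l2Vec (activeDomain Ω 𝒦) v v ≤ B₁ * mhForm γm p h Ω 𝒦 v v := by
      refine h1.trans ?_
      rw [hB₁, mul_assoc]
      exact mul_le_mul_of_nonneg_left (add_le_mul_add hγm hv0 hJ) hC₁.le
    refine (Real.sqrt_le_sqrt h5).trans ?_
    rw [Real.sqrt_mul hB₁0.le]
    gcongr
    linarith
  · have h5 : l2Grad (activeDomain Ω 𝒦) v v ≤ B₂ * ahGradNormSq γa p h Ω 𝒦 v := by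
      refine h2.trans ?_
      rw [hB₂, mul_assoc, ahGradNormSq, mul_assoc γa]
      exact mul_le_mul_of_nonneg_left (add_le_mul_add hγa hg0 hJ') hC₂.le
    refine (Real.sqrt_le_sqrt h5).trans ?_
    rw [Real.sqrt_mul hB₂0.le]
    gcongr
    linarith
  · have h6 : c * (l2Strain Ω v v + γa / c * ((h ^ 2)⁻¹ * jForm p h Ω 𝒦 v v)) ≤
        tripleNormSq μ lam γa p h Ω ΓD 𝒦 v := by
      rw [tripleNormSq, ahForm, mul_add, ← mul_assoc c (γa / c), mul_div_cancel₀ _ hc0.ne',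
        ← mul_assoc γa]
      linarith
    have h7 : 0 ≤ tripleNormSq μ lam γa p h Ω ΓD 𝒦 v := le_trans (by positivity) h6
    calc _ ≤ _ := hup
      _ ≤ A * C₃ * ((1 + (γa / c)⁻¹) *
            (l2Strain Ω v v + γa / c * ((h ^ 2)⁻¹ * jForm p h Ω 𝒦 v v))) :=
          mul_le_mul_of_nonneg_left (add_le_mul_add (by positivity) hs0 hJ') hAC
      _ = B₃ * (c * (l2Strain Ω v v + γa / c * ((h ^ 2)⁻¹ * jForm p h Ω 𝒦 v v))) := by
          rw [hB₃]; field_simp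
      _ ≤ B₃ * tripleNormSq μ lam γa p h Ω ΓD 𝒦 v := by gcongr
      _ ≤ _ := by gcongr; linarith
  · have h6 : l2Grad Ω v v + γa * ((h ^ 2)⁻¹ * jForm p h Ω 𝒦 v v) ≤
        tripleGradNormSq μ lam γa p h Ω ΓD 𝒦 v := by
      rw [tripleGradNormSq, ahGradNormSq, ← mul_assoc γa]
      linarith
    have h7 : 0 ≤ tripleGradNormSq μ lam γa p h Ω ΓD 𝒦 v := le_trans (by positivity) h6
    calc _ ≤ _ := hup
      _ ≤ A * C₃ * (l2Grad Ω v v + (h ^ 2)⁻¹ * jForm p h Ω 𝒦 v v) := by gcongr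
      _ ≤ A * C₃ * ((1 + γa⁻¹) * (l2Grad Ω v v + γa * ((h ^ 2)⁻¹ * jForm p h Ω 𝒦 v v))) :=
          mul_le_mul_of_nonneg_left (add_le_mul_add hγa hg0 hJ') hAC
      _ = B₄ * (l2Grad Ω v v + γa * ((h ^ 2)⁻¹ * jForm p h Ω 𝒦 v v)) := by
          rw [hB₄]; ring
      _ ≤ B₄ * tripleGradNormSq μ lam γa p h Ω ΓD 𝒦 v := by gcongr
      _ ≤ _ := by gcongr; linarith
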